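/- **Setting.** Let $\Sigma$ be a set of events, $\Sigma^{\le\omega}=\Sigma^*\cup\Sigma^\omega$, and for $A\subseteq\Sigma^*$ let $A^\omega\subseteq\Sigma^{\le\omega}$ be the set of all (finite or infinite) words $w_0w_1w_2\cdots$ with all $w_i\in A$. Expressions are $e::=o(a)\mid f\mid e_1;e_2\mid e_1\,?\,e_2$ with $a\in\Sigma$ and $f$ in a finite set $\mathcal F$ of (non-primitive) procedures; a program assigns to each $f\in\mathcal F$ an expression $e_f$. Over $\Sigma\uplus\{\checkmark\}$, let $e\Downarrow w$ and $e\Uparrow w$ ($w$ finite) be the least relations with: $o(a)\Downarrow a$; $o(a)\Uparrow a$; $e\Uparrow\epsilon$; $e_f\Downarrow w\Rightarrow f\Downarrow\checkmark w$; $e_f\Uparrow w\Rightarrow f\Uparrow\checkmark w$; $e_1\Downarrow w,\ e_2\Downarrow u\Rightarrow e_1;e_2\Downarrow wu$; $e_1\Downarrow w,\ e_2\Uparrow u\Rightarrow e_1;e_2\Uparrow wu$; $e_1\Uparrow w\Rightarrow e_1;e_2\Uparrow w$; and, for $i=1,2$, $e_i\Downarrow w\Rightarrow e_1?e_2\Downarrow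 w$ and $e_i\Uparrow w\Rightarrow e_1?e_2\Uparrow w$. Let $\theta$ delete all $\checkmark$. Write $e\downarrow w$ if $w=\theta(w')$ for some $w'$ with $e\Downarrow w'$, and $e\uparrow w$ if $w=\theta(w')$ for some infinite $w'$ all of whose finite prefixes $u$ satisfy $e\Uparrow u$. Let $T(f)=\{w\mid f\downarrow w\text{ or }f\uparrow w\}\subseteq\Sigma^{\le\omega}$. Let $\mathfrak A=(Q,\Sigma,\delta,q_0,F)$ be an extended Büchi automaton: $Q$ is finite, $\delta:Q\times\Sigma\to\mathcal P(Q)$, $q_0\in Q$, $F\subseteq Q$, and $L(\mathfrak A)\subseteq\Sigma^{\le\omega}$ consists of the finite words accepted by $\mathfrak A$ as an NFA and the infinite words accepted by $\mathfrak A$ as a Büchi automaton. For $w,u\in\Sigma^+$ put $w\sim u$ if for all states $p,q$ the words $w$ and $u$ agree on whether $q$ can be reached from $p$, and on whether $q$ can be reached from $p$ by a path that visits $F$ (end points included). Let $\mathcal Q=\Sigma^+/{\sim}\uplus\{[\epsilon]\}$ with $[\epsilon]=\{\epsilon\}$, a monoid under the concatenation of representatives, and $\mathcal C=\{(C,D)\in\mathcal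 Q^2\mid CD=C,\ DD=D\}$. Put $\mathfrak f(V)=\{(C,D)\in\mathcal C\mid CD^\omega\cap V\ne\emptyset\}$, $\mathfrak g(\mathcal V)=\bigcup_{(C,D)\in\mathcal V}CD^\omega$, $\mathfrak c(\mathcal V)=\bigcup_{n\ge1}(\mathfrak f\circ\mathfrak g)^n(\mathcal V)$, $\mathcal M_*=\mathcal P(\mathcal Q)$, $\mathcal M_{\le\omega}=\{\mathfrak c(\mathfrak f(V))\mid V\subseteq\Sigma^{\le\omega}\}$, $\alpha_*(U)=\{C\in\mathcal Q\mid C\cap U\neq\emptyset\}$, $\alpha_{\le\omega}=\mathfrak c\circ\mathfrak f$, $\gamma_*(\mathcal U)=\bigcup_{C\in\mathcal U}C$, $\gamma_{\le\omega}=\mathfrak g$. For $\mathcal U,\mathcal U',\mathcal A\in\mathcal M_*$ and $\mathcal V\in\mathcal M_{\le\omega}$ let $\mathcal U\cdot\mathcal U'=\{UU'\mid U\in\mathcal U,U'\in\mathcal U'\}$, $\mathcal U\cdot\mathcal V=\{(AC,D)\mid A\in\mathcal U,(C,D)\in\mathcal V\}$, let $\mathcal A^*$ be the submonoid of $\mathcal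 Q$ generated by $\mathcal A$, and $\mathcal A^\omega=\alpha_{\le\omega}(\gamma_*(\mathcal A)^\omega)$. Let $\mathfrak X$ be a set of variables that contains a separate variable for each procedure. Effect expressions are formal unions $\mathcal V(\mathfrak X)=\bigcup_{X\in\mathfrak X}\mathcal A_X\cdot X\cup\mathcal B$ with $\mathcal A_X\in\mathcal M_*$, $\mathcal B\in\mathcal M_{\le\omega}$, with union and left multiplication by elements of $\mathcal M_*$ defined coefficientwise; the variable $X$ stands for the expression with $\mathcal A_X=\{[\epsilon]\}$ and all else empty, and $\mathcal V(\mathfrak X-X)$ denotes an expression with $\mathcal A_X=\emptyset$. Environments $\Delta$ are sets of items $f\,\&\,(\mathcal U,X)$ in which different items have different variables. The judgements $\Delta\vdash_{\mathfrak A}e\,\&\,(\mathcal U,\mathcal V(\mathfrak X))$ are generated by the rules: 1. $\Delta\vdash_{\mathfrak A}o(a)\,\&\,(\alpha_*(\{a\}),\emptyset)$; 2. from $\Delta\vdash_{\mathfrak A}e_i\,\&\,(\mathcal U_i,\mathcal V_i(\mathfrak X))$ for $i=1,2$, infer $\Delta\vdash_{\mathfrak A}e_1;e_2\,\&\,(\mathcal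 U_1\cdot\mathcal U_2,\ \mathcal V_1(\mathfrak X)\cup\mathcal U_1\cdot\mathcal V_2(\mathfrak X))$ and $\Delta\vdash_{\mathfrak A}e_1?e_2\,\&\,(\mathcal U_1\cup\mathcal U_2,\ \mathcal V_1(\mathfrak X)\cup\mathcal V_2(\mathfrak X))$; 3. $\Delta\vdash_{\mathfrak A}f\,\&\,(\mathcal U,X)$ if $f\,\&\,(\mathcal U,X)$ is in $\Delta$; 4. from $\Delta,\,f\,\&\,(\mathcal U,X)\vdash_{\mathfrak A}e_f\,\&\,(\mathcal U,\ \mathcal A\cdot X\cup\mathcal V(\mathfrak X-X))$ with $X$ not used in $\Delta$, infer $\Delta\vdash_{\mathfrak A}f\,\&\,(\mathcal U,\ \mathcal A^*\cdot\mathcal V(\mathfrak X-X)\cup\mathcal A^\omega)$. **Theorem (Completeness).** For every program, every extended Büchi automaton $\mathfrak A$ over $\Sigma$ and every procedure $f\in\mathcal F$ there are $\mathcal U_f\in\mathcal M_*$ and $\mathcal V_f\in\mathcal M_{\le\omega}$ such that the judgement $\vdash_{\mathfrak A}f\,\&\,(\mathcal U_f,\mathcal V_f)$ is derivable from the empty environment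 and $$T(f)\subseteq L(\mathfrak A)\quad\Longleftrightarrow\quad\gamma_*(\mathcal U_f)\cup\gamma_{\le\omega}(\mathcal V_f)\subseteq L(\mathfrak A).$$ -/

import Mathlib

namespace BuchiEffect

/-! ### Finite and infinite words -/

/-- A trace over the alphabet `α`: a finite or an infinite word. -/
inductive Trace (α : Type*) where
  | fin : List α → Trace α
  | inf : (ℕ → α) → Trace α

namespace Trace

variable {α : Type*}

/-- `HasPrefix l w`: the finite word `l` is a prefix of the trace `w`. -/
def HasPrefix (l : List α) : Trace α → Prop
  | fin w => l <+: w
  | inf s => ∀ (i : ℕ) (h : i < l.length), l[i] = s i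

/-- Concatenation of a finite word with a trace. -/
def append (l : List α) : Trace α → Trace α
  | fin w => fin (l ++ w)
  | inf s => inf fun n => if h : n < l.length then l[n] else s (n - l.length)

/-- The finite word `u 0 ⬝ u 1 ⬝ … ⬝ u (n - 1)`. -/
def partialCat (u : ℕ → List α) (n : ℕ) : List α :=
  (List.range n).flatMap u

/-- `IsInfCat u w`: the (finite or infinite) trace `w` is the infinite concatenation
`u 0 ⬝ u 1 ⬝ u 2 ⬝ …`, that is, the finite prefixes of `w` are exactly the prefixes of the
words `u 0 ⬝ … ⬝ u (n - 1)`. Exactly one such `w` exists, see `existsUnique_isInfCat`. -/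
def IsInfCat (u : ℕ → List α) (w : Trace α) : Prop :=
  ∀ l : List α, HasPrefix l w ↔ ∃ n, l <+: partialCat u n

/-- The concatenation `A ⬝ V` of a language of finite words and a set of traces. -/
def catSet (A : Set (List α)) (V : Set (Trace α)) : Set (Trace α) :=
  {w | ∃ a ∈ A, ∃ v ∈ V, w = append a v}

/-- `A^ω`, the set of all `w₀w₁w₂…` with all `wᵢ ∈ A` (it contains finite words if `ε ∈ A`). -/
def omegaPow (A : Set (List α)) : Set (Trace α) :=
  {w | ∃ u : ℕ → List α, (∀ i, u i ∈ A) ∧ IsInfCat u w}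

/-! Elementary facts on words. -/

/-- The letter at position `i`, if there is one. -/
def get? : Trace α → ℕ → Option α
  | fin w, i => w[i]?
  | inf s, i => some (s i)

theorem get?_injective {v w : Trace α} (h : ∀ i, v.get? i = w.get? i) : v = w := by
  cases v with
  | fin v =>
    cases w with
    | fin w => exact congrArg fin (List.ext_getElem? h)
    | inf s => simpa [get?] using h v.length
  | inf r =>
    cases w with
    | fin w => simpa [get?] using h w.length
    | inf s => exact congrArg inf (funext fun i => by simpa [get?] using h i)

theorem hasPrefix_iff {l : List α} {w : Trace α} :
    HasPrefix l w ↔ ∀ i < l.length, l[i]? = w.get? i := by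
  cases w with
  | fin w =>
    simp only [HasPrefix, get?]
    exact List.prefix_iff_getElem?.trans
      ⟨fun h i hi => by rw [h i hi, List.getElem?_eq_getElem hi],
       fun h i hi => by rw [← h i hi, List.getElem?_eq_getElem hi]⟩
  | inf s =>
    simp only [HasPrefix, get?]
    exact ⟨fun h i hi => by rw [List.getElem?_eq_getElem hi, h i hi],
      fun h i hi => by simpa [List.getElem?_eq_getElem hi] using h i hi⟩

theorem get?_append (l : List α) (w : Trace α) (i : ℕ) :
    (append l w).get? i = if i < l.length then l[i]? else w.get? (i - l.length) := by
  cases w with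
  | fin w => simp only [append, get?]; exact List.getElem?_append
  | inf s =>
    simp only [append, get?]
    split_ifs with h
    · rw [List.getElem?_eq_getElem h]
    · rfl

theorem append_append (k l : List α) (w : Trace α) :
    append (k ++ l) w = append k (append l w) := by
  apply get?_injective
  intro i
  simp only [get?_append, List.length_append, List.getElem?_append]
  grind

theorem append_cancel {l : List α} {v w : Trace α} (h : append l v = append l w) : v = w := by
  apply get?_injective
  intro i
  have := congrArg (fun t => t.get? (l.length + i)) h
  simpa [get?_append] using this

theorem hasPrefix_append {k l : List α} {w : Trace α} :
    HasPrefix (k ++ l) (append k w) ↔ HasPrefix l w := by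
  simp only [hasPrefix_iff, get?_append, List.length_append, List.getElem?_append]
  constructor
  · intro h i hi
    have := h (k.length + i) (by omega)
    simpa using this
  · intro h i hi
    split_ifs with hk
    · rfl
    · exact h _ (by omega)

theorem hasPrefix_append_self (k : List α) (w : Trace α) : HasPrefix k (append k w) := by
  simp only [hasPrefix_iff, get?_append]
  intro i hi
  simp [hi]

theorem HasPrefix.of_prefix {k l : List α} {w : Trace α} (hkl : k <+: l)
    (h : HasPrefix l w) : HasPrefix k w := by
  rw [hasPrefix_iff] at h ⊢
  intro i hi
  rw [← h i (hi.trans_le hkl.length_le)]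
  obtain ⟨t, rfl⟩ := hkl
  exact (List.getElem?_append_left hi).symm

theorem HasPrefix.exists_append {l : List α} {w : Trace α} (h : HasPrefix l w) :
    ∃ r, w = append l r := by
  cases w with
  | fin w => obtain ⟨t, rfl⟩ := h; exact ⟨fin t, rfl⟩
  | inf s =>
    refine ⟨inf fun n => s (l.length + n), get?_injective fun i => ?_⟩
    rw [get?_append]
    split_ifs with hi
    · exact ((hasPrefix_iff.1 h) i hi).symm
    · simp only [get?]; congr 2; omega

theorem HasPrefix.total {k l : List α} {w : Trace α} (hk : HasPrefix k w) (hl : HasPrefix l w)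
    (hlen : k.length ≤ l.length) : k <+: l := by
  rw [hasPrefix_iff] at hk hl
  rw [List.prefix_iff_getElem?]
  intro i hi
  rw [hl i (hi.trans_le hlen), ← hk i hi, List.getElem?_eq_getElem hi]

theorem ext_hasPrefix {v w : Trace α} (h : ∀ l, HasPrefix l v ↔ HasPrefix l w) : v = w := by
  have key : ∀ {v w : Trace α}, (∀ l, HasPrefix l v → HasPrefix l w) →
      ∀ i a, v.get? i = some a → w.get? i = some a := by
    intro v w h i a hv
    have : ∃ l, HasPrefix l v ∧ i < l.length := by
      cases v with
      | fin v => exact ⟨v, List.prefix_rfl, (List.getElem?_eq_some_iff.1 hv).1⟩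
      | inf s => exact ⟨(List.range (i + 1)).map s, by simp [HasPrefix], by simp⟩
    obtain ⟨l, hl, hi⟩ := this
    rw [← hasPrefix_iff.1 (h l hl) i hi, hasPrefix_iff.1 hl i hi, hv]
  apply get?_injective
  intro i
  ext a
  exact ⟨key (fun l => (h l).1) i a, key (fun l => (h l).2) i a⟩

theorem partialCat_succ (u : ℕ → List α) (n : ℕ) :
    partialCat u (n + 1) = partialCat u n ++ u n := by
  simp [partialCat, List.range_succ]

theorem partialCat_add (u : ℕ → List α) (k n : ℕ) :
    partialCat u (k + n) = partialCat u k ++ partialCat (fun i => u (k + i)) n := by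
  induction n with
  | zero => simp [partialCat]
  | succ n ih => rw [← add_assoc, partialCat_succ, ih, partialCat_succ, List.append_assoc]

theorem partialCat_prefix (u : ℕ → List α) {m n : ℕ} (h : m ≤ n) :
    partialCat u m <+: partialCat u n := by
  obtain ⟨k, rfl⟩ := Nat.exists_eq_add_of_le h
  rw [partialCat_add]
  exact List.prefix_append _ _

/-- Infinite concatenations exist and are unique. -/
theorem existsUnique_isInfCat (u : ℕ → List α) : ∃! w, IsInfCat u w := by
  refine existsUnique_of_exists_of_unique ?_
    fun v w hv hw => ext_hasPrefix fun l => (hv l).trans (hw l).symm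
  by_cases hb : ∃ N, ∀ n, (partialCat u n).length ≤ (partialCat u N).length
  · obtain ⟨N, hN⟩ := hb
    refine ⟨fin (partialCat u N), fun l => ⟨fun h => ⟨N, h⟩, ?_⟩⟩
    rintro ⟨n, hn⟩
    refine hn.trans ?_
    rcases le_total n N with h | h
    · exact partialCat_prefix u h
    · rw [(partialCat_prefix u h).eq_of_length_le (hN n)]
  · push Not at hb
    have hlen : ∀ k, ∃ n, k < (partialCat u n).length := by
      intro k
      induction k with
      | zero => obtain ⟨n, hn⟩ := hb 0; exact ⟨n, by omega⟩
      | succ k ih =>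
        obtain ⟨m, hm⟩ := ih
        obtain ⟨n, hn⟩ := hb m
        exact ⟨n, by omega⟩
    choose N hN using hlen
    have hs : ∀ n, HasPrefix (partialCat u n) (inf fun k => (partialCat u (N k))[k]'(hN k)) := by
      intro n i hi
      rcases le_total n (N i) with h | h
      · exact (partialCat_prefix u h).getElem hi
      · exact ((partialCat_prefix u h).getElem (hN i)).symm
    refine ⟨_, fun l => ⟨fun h => ⟨N l.length, h.total (hs _) (hN _).le⟩, ?_⟩⟩
    rintro ⟨n, hn⟩
    exact (hs n).of_prefix hn

theorem IsInfCat.hasPrefix {u : ℕ → List α} {w : Trace α} (h : IsInfCat u w) (n : ℕ) :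
    HasPrefix (partialCat u n) w :=
  (h _).2 ⟨n, List.prefix_rfl⟩

/-- Splitting off the first `k` factors of an infinite concatenation. -/
theorem IsInfCat.drop {u : ℕ → List α} {w : Trace α} (h : IsInfCat u w) (k : ℕ) :
    ∃ r, w = append (partialCat u k) r ∧ IsInfCat (fun i => u (k + i)) r := by
  obtain ⟨r, rfl⟩ := (h.hasPrefix k).exists_append
  refine ⟨r, rfl, fun l => ?_⟩
  rw [← hasPrefix_append (k := partialCat u k), h]
  constructor
  · rintro ⟨n, hn⟩
    refine ⟨n, ?_⟩
    rw [← List.prefix_append_right_inj (partialCat u k), ← partialCat_add]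
    exact hn.trans (partialCat_prefix u (by omega))
  · rintro ⟨n, hn⟩
    refine ⟨k + n, ?_⟩
    rw [partialCat_add]
    exact (List.prefix_append_right_inj _).2 hn

end Trace

/-! ### Programs and their traces -/

/-- Expressions over events `Ev` and (non-primitive) procedure identifiers `Proc`:
`o(a)`, a procedure call, `e₁ ; e₂` and the nondeterministic choice `e₁ ? e₂`. -/
inductive Expr (Ev Proc : Type*) where
  | out : Ev → Expr Ev Proc
  | call : Proc → Expr Ev Proc
  | seq : Expr Ev Proc → Expr Ev Proc → Expr Ev Proc
  | choice : Expr Ev Proc → Expr Ev Proc → Expr Ev Proc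

/-- A program assigns to every procedure identifier its defining expression. -/
abbrev Program (Ev Proc : Type*) := Proc → Expr Ev Proc

section Semantics

variable {Ev Proc : Type*}

/-- Observed extended semantics of terminating executions, `e ⇓ w`. The tick event is `none`, an
event `a` is `some a`. Every procedure call issues a tick. -/
inductive Terminates (P : Program Ev Proc) : Expr Ev Proc → List (Option Ev) → Prop
  | out (a : Ev) : Terminates P (.out a) [some a]
  | call {f : Proc} {w} : Terminates P (P f) w → Terminates P (.call f) (none :: w)
  | seq {e₁ e₂ w u} : Terminates P e₁ w → Terminates P e₂ u → Terminates P (.seq e₁ e₂) (w ++ u)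
  | choice_left {e₁ e₂ w} : Terminates P e₁ w → Terminates P (.choice e₁ e₂) w
  | choice_right {e₁ e₂ w} : Terminates P e₂ w → Terminates P (.choice e₁ e₂) w

/-- Observed extended semantics of partial executions, `e ⇑ w`. -/
inductive Observes (P : Program Ev Proc) : Expr Ev Proc → List (Option Ev) → Prop
  | out (a : Ev) : Observes P (.out a) [some a]
  | nil (e : Expr Ev Proc) : Observes P e []
  | call {f : Proc} {w} : Observes P (P f) w → Observes P (.call f) (none :: w)
  | seq_right {e₁ e₂ w u} : Terminates P e₁ w → Observes P e₂ u → Observes P (.seq e₁ e₂) (w ++ u)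
  | seq_left {e₁ e₂ w} : Observes P e₁ w → Observes P (.seq e₁ e₂) w
  | choice_left {e₁ e₂ w} : Observes P e₁ w → Observes P (.choice e₁ e₂) w
  | choice_right {e₁ e₂ w} : Observes P e₂ w → Observes P (.choice e₁ e₂) w

/-- `IsErasure s w`: removing all ticks from the infinite extended word `s` yields the (finite or
infinite) trace `w`. -/
def IsErasure (s : ℕ → Option Ev) (w : Trace Ev) : Prop :=
  Trace.IsInfCat (fun i => (s i).toList) w

/-- `e ↓ w`: some terminating execution of `e` has the trace `w`. -/
def TermTrace (P : Program Ev Proc) (e : Expr Ev Proc) (w : List Ev) : Prop :=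
  ∃ w', Terminates P e w' ∧ w = w'.reduceOption

/-- `e ↑ w`: some nonterminating execution of `e` has the trace `w`. -/
def NontermTrace (P : Program Ev Proc) (e : Expr Ev Proc) (w : Trace Ev) : Prop :=
  ∃ s : ℕ → Option Ev, (∀ u, Trace.HasPrefix u (.inf s) → Observes P e u) ∧ IsErasure s w

/-- The set `T(f)` of all traces of the procedure `f`. -/
def traces (P : Program Ev Proc) (f : Proc) : Set (Trace Ev) :=
  {w | (∃ l, w = .fin l ∧ TermTrace P (.call f) l) ∨ NontermTrace P (.call f) w}

end Semantics

/-! ### Extended Büchi automata -/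

/-- An extended Büchi automaton with state set `Q` over the alphabet `Ev`. -/
structure ExtBuchi (Q Ev : Type*) where
  /-- transition function -/
  δ : Q → Ev → Set Q
  /-- initial state -/
  q₀ : Q
  /-- final states -/
  F : Set Q

namespace ExtBuchi

variable {Q Ev : Type*} (𝔄 : ExtBuchi Q Ev)

/-- `Reach p w q`: the state `q` is reachable from `p` by the finite word `w`. -/
def Reach : Q → List Ev → Q → Prop
  | p, [], q => p = q
  | p, a :: w, q => ∃ r ∈ 𝔄.δ p a, Reach r w q

/-- Reachability visiting a final state on the way (end points included). -/
def ReachF (p : Q) (w : List Ev) (q : Q) : Prop :=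
  ∃ r ∈ 𝔄.F, ∃ u v, w = u ++ v ∧ 𝔄.Reach p u r ∧ 𝔄.Reach r v q

/-- Acceptance: of finite words as by an NFA, of infinite words as by a Büchi automaton. -/
def Accepts : Trace Ev → Prop
  | .fin w => ∃ q ∈ 𝔄.F, 𝔄.Reach 𝔄.q₀ w q
  | .inf s => ∃ ρ : ℕ → Q, ρ 0 = 𝔄.q₀ ∧ (∀ n, ρ (n + 1) ∈ 𝔄.δ (ρ n) (s n)) ∧
      ∀ n, ∃ m, n ≤ m ∧ ρ m ∈ 𝔄.F

/-- The language `L(𝔄)`. -/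
def lang : Set (Trace Ev) := {w | 𝔄.Accepts w}

/-- The relation `w ∼ u` (used for nonempty words). -/
def Sim (w u : List Ev) : Prop :=
  ∀ p q, (𝔄.Reach p w q ↔ 𝔄.Reach p u q) ∧ (𝔄.ReachF p w q ↔ 𝔄.ReachF p u q)

theorem reach_append {p q : Q} {w u : List Ev} :
    𝔄.Reach p (w ++ u) q ↔ ∃ r, 𝔄.Reach p w r ∧ 𝔄.Reach r u q := by
  induction w generalizing p with
  | nil => simp [Reach]
  | cons a w ih => simp only [List.cons_append, Reach, ih]; grind

theorem reachF_append {p q : Q} {w u : List Ev} :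
    𝔄.ReachF p (w ++ u) q ↔
      ∃ r, (𝔄.ReachF p w r ∧ 𝔄.Reach r u q) ∨ (𝔄.Reach p w r ∧ 𝔄.ReachF r u q) := by
  constructor
  · rintro ⟨r, hr, x, y, hxy, h₁, h₂⟩
    rcases List.append_eq_append_iff.1 hxy with ⟨z, rfl, rfl⟩ | ⟨z, rfl, rfl⟩
    · obtain ⟨s, hs, hs'⟩ := 𝔄.reach_append.1 h₁
      exact ⟨s, .inr ⟨hs, r, hr, z, y, rfl, hs', h₂⟩⟩
    · obtain ⟨s, hs, hs'⟩ := 𝔄.reach_append.1 h₂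
      exact ⟨s, .inl ⟨⟨r, hr, x, z, rfl, h₁, hs⟩, hs'⟩⟩
  · rintro ⟨s, ⟨⟨r, hr, x, y, rfl, h₁, h₂⟩, h₃⟩ | ⟨h₁, r, hr, x, y, rfl, h₂, h₃⟩⟩
    · exact ⟨r, hr, x, y ++ u, List.append_assoc .., h₁, 𝔄.reach_append.2 ⟨s, h₂, h₃⟩⟩
    · exact ⟨r, hr, w ++ x, y, (List.append_assoc ..).symm, 𝔄.reach_append.2 ⟨s, h₁, h₂⟩, h₃⟩

theorem Sim.append {w w' u u' : List Ev} (h : 𝔄.Sim w u) (h' : 𝔄.Sim w' u') :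
    𝔄.Sim (w ++ w') (u ++ u') := by
  intro p q
  simp only [reach_append, reachF_append, (h _ _).1, (h _ _).2, (h' _ _).1, (h' _ _).2, and_self]

/-- The congruence on the free monoid whose classes are the `∼`-classes of nonempty words and the
additional class `{ε}`. -/
def con : Con (FreeMonoid Ev) where
  r w u := (w.toList = [] ∧ u.toList = []) ∨
    (w.toList ≠ [] ∧ u.toList ≠ [] ∧ 𝔄.Sim w.toList u.toList)
  iseqv :=
    { refl := fun w => by
        by_cases h : w.toList = []
        · exact .inl ⟨h, h⟩
        · exact .inr ⟨h, h, fun _ _ => ⟨Iff.rfl, Iff.rfl⟩⟩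
      symm := fun h => by
        rcases h with ⟨h₁, h₂⟩ | ⟨h₁, h₂, h₃⟩
        · exact .inl ⟨h₂, h₁⟩
        · exact .inr ⟨h₂, h₁, fun p q => ⟨(h₃ p q).1.symm, (h₃ p q).2.symm⟩⟩
      trans := fun h k => by
        rcases h with ⟨h₁, h₂⟩ | ⟨h₁, h₂, h₃⟩ <;> rcases k with ⟨k₁, k₂⟩ | ⟨k₁, k₂, k₃⟩
        · exact .inl ⟨h₁, k₂⟩
        · exact absurd h₂ k₁
        · exact absurd k₁ h₂
        · exact .inr ⟨h₁, k₂, fun p q => ⟨(h₃ p q).1.trans (k₃ p q).1,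
            (h₃ p q).2.trans (k₃ p q).2⟩⟩ }
  mul' := fun {w x y z} h k => by
    simp only [FreeMonoid.toList_mul]
    rcases h with ⟨h₁, h₂⟩ | ⟨h₁, h₂, h₃⟩ <;> rcases k with ⟨k₁, k₂⟩ | ⟨k₁, k₂, k₃⟩
    · exact .inl ⟨by simp [h₁, k₁], by simp [h₂, k₂]⟩
    · exact .inr ⟨by simp [k₁], by simp [k₂], by simpa [h₁, h₂] using k₃⟩
    · exact .inr ⟨by simp [h₁], by simp [h₂], by simpa [k₁, k₂] using h₃⟩
    · exact .inr ⟨by simp [h₁], by simp [h₂], h₃.append 𝔄 k₃⟩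

/-- The monoid of classes, `Σ⁺/∼ ⊎ {[ε]}`. -/
abbrev Cls := 𝔄.con.Quotient

/-- The class `[w]` of a finite word. -/
def cls (w : List Ev) : 𝔄.Cls := ((FreeMonoid.ofList w : FreeMonoid Ev) : 𝔄.con.Quotient)

/-- A class as a set of words. -/
def words (C : 𝔄.Cls) : Set (List Ev) := {w | 𝔄.cls w = C}

theorem cls_append (w u : List Ev) : 𝔄.cls (w ++ u) = 𝔄.cls w * 𝔄.cls u := rfl

theorem words_nonempty (C : 𝔄.Cls) : ∃ w, 𝔄.cls w = C := by
  obtain ⟨w, rfl⟩ := Con.mk'_surjective C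
  exact ⟨w.toList, rfl⟩

/-! ### The Büchi abstraction -/

/-- The set `𝒞` of pairs of classes `(C, D)` with `CD = C` and `DD = D`. -/
abbrev LPair := {p : 𝔄.Cls × 𝔄.Cls // p.1 * p.2 = p.1 ∧ p.2 * p.2 = p.2}

/-- The set of traces `C D^ω`. -/
def lasso (p : 𝔄.LPair) : Set (Trace Ev) :=
  Trace.catSet (𝔄.words p.1.1) (Trace.omegaPow (𝔄.words p.1.2))

/-- The pre-abstraction `𝔣`. -/
def preAbs (V : Set (Trace Ev)) : Set 𝔄.LPair := {p | (𝔄.lasso p ∩ V).Nonempty}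

/-- The pre-concretization `𝔤`. -/
def preConc (𝒱 : Set 𝔄.LPair) : Set (Trace Ev) := ⋃ p ∈ 𝒱, 𝔄.lasso p

/-- The closure `𝔠(𝒱)`, the union of all `(𝔣 ∘ 𝔤)ⁿ(𝒱)` with `n ≥ 1`. -/
def clos (𝒱 : Set 𝔄.LPair) : Set 𝔄.LPair :=
  ⋃ n : ℕ, (fun 𝒲 => 𝔄.preAbs (𝔄.preConc 𝒲))^[n + 1] 𝒱

/-- The abstract domain `ℳ_*`: sets of classes. -/
abbrev MStar := Set 𝔄.Cls

/-- The abstract domain `ℳ_{≤ω}`: the sets `𝔠(𝔣(V))` with `V` a set of traces. -/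
abbrev MOmega := {𝒱 : Set 𝔄.LPair // ∃ V : Set (Trace Ev), 𝒱 = 𝔄.clos (𝔄.preAbs V)}

/-- Abstraction `α_*`. -/
def alphaStar (U : Set (List Ev)) : 𝔄.MStar := {C | (𝔄.words C ∩ U).Nonempty}

/-- Concretization `γ_*`. -/
def gammaStar (𝒰 : 𝔄.MStar) : Set (List Ev) := ⋃ C ∈ 𝒰, 𝔄.words C

/-- Abstraction `α_{≤ω}`. -/
def alphaOmega (V : Set (Trace Ev)) : 𝔄.MOmega := ⟨𝔄.clos (𝔄.preAbs V), V, rfl⟩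

/-- Concretization `γ_{≤ω}`. -/
def gammaOmega (𝒱 : 𝔄.MOmega) : Set (Trace Ev) := 𝔄.preConc 𝒱.1

/-! The members of `ℳ_{≤ω}` are the closed sets of pairs; they are stable under the operations. -/

theorem lasso_nonempty (p : 𝔄.LPair) : (𝔄.lasso p).Nonempty := by
  obtain ⟨c, hc⟩ := 𝔄.words_nonempty p.1.1
  obtain ⟨d, hd⟩ := 𝔄.words_nonempty p.1.2
  obtain ⟨t, ht, -⟩ := Trace.existsUnique_isInfCat fun _ : ℕ => d
  exact ⟨_, c, hc, t, ⟨fun _ => d, fun _ => hd, ht⟩, rfl⟩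

theorem mem_preAbs_preConc {𝒱 : Set 𝔄.LPair} {p : 𝔄.LPair} :
    p ∈ 𝔄.preAbs (𝔄.preConc 𝒱) ↔ ∃ q ∈ 𝒱, (𝔄.lasso p ∩ 𝔄.lasso q).Nonempty := by
  simp only [preAbs, preConc, Set.Nonempty, Set.mem_inter_iff, Set.mem_iUnion, Set.mem_ofPred_eq]
  grind

theorem mem_MOmega_iff {𝒱 : Set 𝔄.LPair} :
    (∃ V : Set (Trace Ev), 𝒱 = 𝔄.clos (𝔄.preAbs V)) ↔
      ∀ p q, q ∈ 𝒱 → (𝔄.lasso p ∩ 𝔄.lasso q).Nonempty → p ∈ 𝒱 := by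
  constructor
  · rintro ⟨V, rfl⟩ p q hq hpq
    obtain ⟨n, hn⟩ := Set.mem_iUnion.1 hq
    refine Set.mem_iUnion.2 ⟨n + 1, ?_⟩
    rw [Function.iterate_succ_apply']
    exact 𝔄.mem_preAbs_preConc.2 ⟨q, hn, hpq⟩
  · intro h
    have hfix : 𝔄.preAbs (𝔄.preConc 𝒱) = 𝒱 := by
      ext p
      rw [mem_preAbs_preConc]
      refine ⟨fun ⟨q, hq, hpq⟩ => h p q hq hpq, fun hp => ⟨p, hp, ?_⟩⟩
      simpa using 𝔄.lasso_nonempty p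
    refine ⟨𝔄.preConc 𝒱, ?_⟩
    rw [hfix, clos]
    have : ∀ n : ℕ, (fun 𝒲 => 𝔄.preAbs (𝔄.preConc 𝒲))^[n + 1] 𝒱 = 𝒱 := fun n =>
      Function.iterate_fixed (f := fun 𝒲 => 𝔄.preAbs (𝔄.preConc 𝒲)) hfix (n + 1)
    simp only [this, Set.iUnion_const]

/-- The empty element of `ℳ_{≤ω}`. -/
def omegaEmpty : 𝔄.MOmega := ⟨∅, 𝔄.mem_MOmega_iff.2 fun _ _ h => h.elim⟩

/-- Union on `ℳ_{≤ω}`. -/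
def omegaUnion (𝒱 𝒲 : 𝔄.MOmega) : 𝔄.MOmega :=
  ⟨𝒱.1 ∪ 𝒲.1, 𝔄.mem_MOmega_iff.2 fun p q hq hpq =>
    hq.imp (fun h => 𝔄.mem_MOmega_iff.1 𝒱.2 p q h hpq)
      (fun h => 𝔄.mem_MOmega_iff.1 𝒲.2 p q h hpq)⟩

/-- Concatenation on `ℳ_*`. -/
def starCat (𝒰 𝒰' : 𝔄.MStar) : 𝔄.MStar := {C | ∃ A ∈ 𝒰, ∃ B ∈ 𝒰', C = A * B}

/-- The set of pairs `(AC, D)` with `A ∈ 𝒰` and `(C, D) ∈ 𝒱`. -/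
def catPairs (𝒰 : 𝔄.MStar) (𝒱 : Set 𝔄.LPair) : Set 𝔄.LPair :=
  {p | ∃ A ∈ 𝒰, ∃ q ∈ 𝒱, p.1.1 = A * q.1.1 ∧ p.1.2 = q.1.2}

theorem cls_append_partialCat {U V : 𝔄.Cls} (hUV : U * V = U) {c : List Ev} {d : ℕ → List Ev}
    (hc : 𝔄.cls c = U) (hd : ∀ i, 𝔄.cls (d i) = V) (k : ℕ) :
    𝔄.cls (c ++ Trace.partialCat d k) = U := by
  induction k with
  | zero => simpa [Trace.partialCat] using hc
  | succ k ih => rw [Trace.partialCat_succ, ← List.append_assoc, cls_append, ih, hd, hUV]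

theorem catPairs_mem (𝒰 : 𝔄.MStar) (𝒱 : 𝔄.MOmega) :
    ∃ V : Set (Trace Ev), 𝔄.catPairs 𝒰 𝒱.1 = 𝔄.clos (𝔄.preAbs V) := by
  rw [mem_MOmega_iff]
  rintro p r ⟨A, hA, q, hq, hr₁, hr₂⟩ ⟨w, ⟨c, hc, t, ⟨d, hd, ht⟩, rfl⟩, z, hz, t₁, ht₁, hw⟩
  simp only [words, Set.mem_ofPred_eq] at hc hd hz
  -- some `c ++ partialCat d k` extends `z`
  obtain ⟨k, y, hk⟩ : ∃ k y, c ++ Trace.partialCat d k = z ++ y := by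
    have hzw : Trace.HasPrefix z (Trace.append c t) := hw ▸ Trace.hasPrefix_append_self z t₁
    rcases le_total z.length c.length with h | h
    · obtain ⟨y, hy⟩ := hzw.total (Trace.hasPrefix_append_self c t) h
      exact ⟨0, y, by simp [Trace.partialCat, hy]⟩
    · obtain ⟨x, rfl⟩ := (Trace.hasPrefix_append_self c t).total hzw h
      obtain ⟨n, y, hn⟩ := (ht x).1 (Trace.hasPrefix_append.1 hzw)
      exact ⟨n, y, by rw [← hn, List.append_assoc]⟩
  obtain ⟨s, hs, hs'⟩ := ht.drop (k + 1)
  have ht₁' : t₁ = Trace.append (y ++ d k) s := by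
    apply Trace.append_cancel (l := z)
    rw [← hw, hs, ← Trace.append_append, ← Trace.append_append, Trace.partialCat_succ,
      ← List.append_assoc, hk, List.append_assoc]
  obtain ⟨c₁, hc₁⟩ := 𝔄.words_nonempty q.1.1
  let q' : 𝔄.LPair := ⟨(q.1.1 * 𝔄.cls y * p.1.2, p.1.2), by rw [mul_assoc, p.2.2], p.2.2⟩
  have hq' : q' ∈ 𝒱.1 := by
    refine 𝔄.mem_MOmega_iff.1 𝒱.2 q' q hq ⟨Trace.append c₁ t₁, ?_, ?_⟩
    · refine ⟨c₁ ++ (y ++ d k), ?_, s, ⟨_, fun i => hd _, hs'⟩, ?_⟩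
      · simp only [words, Set.mem_ofPred_eq, cls_append, hc₁, hd, q', mul_assoc]
      · rw [Trace.append_append, ht₁']
    · exact ⟨c₁, hc₁, t₁, hr₂ ▸ ht₁, rfl⟩
  refine ⟨A, hA, q', hq', ?_, rfl⟩
  have h₁ := 𝔄.cls_append_partialCat p.2.1 hc hd k
  rw [hk, cls_append, hz, hr₁] at h₁
  simp only [q', ← mul_assoc]
  rw [h₁, p.2.1]

/-- Concatenation `ℳ_* × ℳ_{≤ω} → ℳ_{≤ω}`. -/
def omegaCat (𝒰 : 𝔄.MStar) (𝒱 : 𝔄.MOmega) : 𝔄.MOmega :=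
  ⟨𝔄.catPairs 𝒰 𝒱.1, 𝔄.catPairs_mem 𝒰 𝒱⟩

/-- Finite iteration `𝒜^*` on `ℳ_*`: all finite products of members of `𝒜`. -/
def starIter (𝒜 : 𝔄.MStar) : 𝔄.MStar := (Submonoid.closure 𝒜 : Set 𝔄.Cls)

/-- Infinite iteration `𝒜^ω = α_{≤ω}(γ_*(𝒜)^ω)`. -/
def omegaIter (𝒜 : 𝔄.MStar) : 𝔄.MOmega :=
  𝔄.alphaOmega (Trace.omegaPow (𝔄.gammaStar 𝒜))

end ExtBuchi

/-! ### The Büchi type and effect system -/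

/-- An effect expression `⋃_X (𝒜_X ⬝ X) ∪ ℬ` over the variables `Var`. -/
structure EffExpr {Q Ev : Type*} (𝔄 : ExtBuchi Q Ev) (Var : Type*) where
  /-- the coefficients `𝒜_X` -/
  coeff : Var → 𝔄.MStar
  /-- the constant part `ℬ` -/
  base : 𝔄.MOmega

namespace EffExpr

variable {Q Ev Var : Type*} {𝔄 : ExtBuchi Q Ev}

/-- The variable-free expression `𝒱`. -/
def const (𝒱 : 𝔄.MOmega) : EffExpr 𝔄 Var := ⟨fun _ => ∅, 𝒱⟩

open Classical in
/-- The expression `X`. -/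
noncomputable def var (X : Var) : EffExpr 𝔄 Var :=
  ⟨fun Y => if Y = X then {1} else ∅, 𝔄.omegaEmpty⟩

/-- The union of two expressions. -/
def union (𝒱 𝒲 : EffExpr 𝔄 Var) : EffExpr 𝔄 Var :=
  ⟨fun X => 𝒱.coeff X ∪ 𝒲.coeff X, 𝔄.omegaUnion 𝒱.base 𝒲.base⟩

/-- The expression `𝒜 ⬝ 𝒱`. -/
def cat (𝒜 : 𝔄.MStar) (𝒱 : EffExpr 𝔄 Var) : EffExpr 𝔄 Var :=
  ⟨fun X => 𝔄.starCat 𝒜 (𝒱.coeff X), 𝔄.omegaCat 𝒜 𝒱.base⟩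

/-- The variable `X` does not occur, that is, the expression has the form `𝒱(𝔛 - X)`. -/
def Avoids (𝒱 : EffExpr 𝔄 Var) (X : Var) : Prop := 𝒱.coeff X = ∅

end EffExpr

/-- An item `f & (𝒰, X)` of an environment. -/
structure Binding {Q Ev : Type*} (𝔄 : ExtBuchi Q Ev) (Proc Var : Type*) where
  /-- the procedure `f` -/
  proc : Proc
  /-- the effect `𝒰` of its terminating executions -/
  eff : 𝔄.MStar
  /-- the variable `X` -/
  var : Var

/-- Environments: sets of bindings in which different bindings have different variables. -/
structure Env {Q Ev : Type*} (𝔄 : ExtBuchi Q Ev) (Proc Var : Type*) where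
  /-- the bindings -/
  items : Set (Binding 𝔄 Proc Var)
  /-- different bindings have different variables -/
  distinct : ∀ b ∈ items, ∀ b' ∈ items, b.var = b'.var → b = b'

namespace Env

variable {Q Ev Proc Var : Type*} {𝔄 : ExtBuchi Q Ev}

/-- The empty environment. -/
def empty : Env 𝔄 Proc Var := ⟨∅, fun _ h => h.elim⟩

/-- The variable `X` is not used in the environment. -/
def Fresh (Δ : Env 𝔄 Proc Var) (X : Var) : Prop := ∀ b ∈ Δ.items, b.var ≠ X

/-- The environment `Δ, f & (𝒰, X)`. -/
def extend (Δ : Env 𝔄 Proc Var) (f : Proc) (𝒰 : 𝔄.MStar) (X : Var) (h : Δ.Fresh X) :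
    Env 𝔄 Proc Var where
  items := insert ⟨f, 𝒰, X⟩ Δ.items
  distinct := by
    rintro b (rfl | hb) b' (rfl | hb') e
    · rfl
    · exact absurd e.symm (h b' hb')
    · exact absurd e (h b hb)
    · exact Δ.distinct b hb b' hb' e

end Env

/-- The judgements `Δ ⊢_𝔄 e & (𝒰, 𝒱(𝔛))` for the program `P`. -/
inductive Derives {Q Ev Proc Var : Type*} (𝔄 : ExtBuchi Q Ev) (P : Program Ev Proc) :
    Env 𝔄 Proc Var → Expr Ev Proc → 𝔄.MStar → EffExpr 𝔄 Var → Prop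
  | out (Δ : Env 𝔄 Proc Var) (a : Ev) :
      Derives 𝔄 P Δ (.out a) (𝔄.alphaStar {[a]}) (.const 𝔄.omegaEmpty)
  | seq {Δ : Env 𝔄 Proc Var} {e₁ e₂ 𝒰₁ 𝒰₂ 𝒱₁ 𝒱₂} :
      Derives 𝔄 P Δ e₁ 𝒰₁ 𝒱₁ → Derives 𝔄 P Δ e₂ 𝒰₂ 𝒱₂ →
      Derives 𝔄 P Δ (.seq e₁ e₂) (𝔄.starCat 𝒰₁ 𝒰₂) (𝒱₁.union (𝒱₂.cat 𝒰₁))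
  | choice {Δ : Env 𝔄 Proc Var} {e₁ e₂ 𝒰₁ 𝒰₂ 𝒱₁ 𝒱₂} :
      Derives 𝔄 P Δ e₁ 𝒰₁ 𝒱₁ → Derives 𝔄 P Δ e₂ 𝒰₂ 𝒱₂ →
      Derives 𝔄 P Δ (.choice e₁ e₂) (𝒰₁ ∪ 𝒰₂) (𝒱₁.union 𝒱₂)
  | hyp {Δ : Env 𝔄 Proc Var} {f : Proc} {𝒰 : 𝔄.MStar} {X : Var} :
      ⟨f, 𝒰, X⟩ ∈ Δ.items → Derives 𝔄 P Δ (.call f) 𝒰 (.var X)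
  | fix {Δ : Env 𝔄 Proc Var} {f : Proc} {𝒰 : 𝔄.MStar} {X : Var} {𝒜 : 𝔄.MStar}
      {𝒱 : EffExpr 𝔄 Var} (hX : Δ.Fresh X) (h𝒱 : 𝒱.Avoids X) :
      Derives 𝔄 P (Δ.extend f 𝒰 X hX) (P f) 𝒰 (((EffExpr.var X).cat 𝒜).union 𝒱) →
      Derives 𝔄 P Δ (.call f) 𝒰 ((𝒱.cat (𝔄.starIter 𝒜)).union (.const (𝔄.omegaIter 𝒜)))

end BuchiEffect

namespace BuchiEffect

/-! ### Block decompositions -/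

/-! The proof derives the exact effects: `𝒰` is the abstraction of the terminating traces of `f`,
and `𝒱` that of its nonterminating traces. Two things make this work: the abstraction loses nothing
about inclusion in the language, and every rule of the calculus is exact.

No loss. Whether the automaton accepts depends only on the classes of the factors, so each class and
each lasso lies inside the language or is disjoint from it (`accepts_congr_of_mem_lasso`). By
Ramsey's theorem every trace lies in some lasso, and infinite concatenations with pairwise
equivalent factors share one (`exists_lasso`). Hence the pairs whose lasso lies inside the language
form a closed set, and the closure `clos` adds no bad pairs.

Exactness. Call-free computation is finite, so a nonterminating execution is an infinite chain of
nested calls (`nontermTrace_iff`). Fix a set `S` of procedures whose calls are treated as variables.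
An expression then has the coefficients `Run P S e · g` for `g ∈ S`, and the constant part `Diverges
P S e`. These satisfy equations that mirror the rules, and the abstraction commutes with each
operation (`alphaOmega_union`, `alphaOmega_catSet`, `alphaStar_starLang`, `omegaIter_alphaStar`).
For recursion, a chain starting in the body of `f` is cut at its calls of `f`. There are either
finitely many, giving `𝒜^* ⬝ 𝒱`, or infinitely many, giving `𝒜^ω` (`run_eq_starLang_append`,
`diverges_eq_starLang_cat`). The derivation is built by induction on growing `S`, which stops
because there are finitely many procedures; at `S = ∅` no variables remain. -/

/-- Sequences of positions `0 = k 0 < k 1 < …` cut `ℕ` into blocks. -/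
theorem exists_block {k : ℕ → ℕ} (hk : StrictMono k) (h0 : k 0 = 0) (n : ℕ) :
    ∃ i j, n = k i + j ∧ n < k (i + 1) := by
  induction n with
  | zero => exact ⟨0, 0, by simp [h0], by have := hk (show 0 < 1 by simp); rwa [h0] at this⟩
  | succ n ih =>
    obtain ⟨i, j, hn, hlt⟩ := ih
    rcases Nat.lt_or_ge (n + 1) (k (i + 1)) with h | h
    · exact ⟨i, j + 1, by omega, h⟩
    · exact ⟨i + 1, 0, by omega, by have := hk (show i + 1 < i + 1 + 1 by simp); omega⟩

/-- Gluing sequences that are given blockwise. -/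
theorem exists_glue {β : Type*} {k : ℕ → ℕ} (hk : StrictMono k) (h0 : k 0 = 0) (π : ℕ → ℕ → β) :
    ∃ ρ : ℕ → β, ∀ i j, k i + j < k (i + 1) → ρ (k i + j) = π i j := by
  choose I J hIJ hlt using exists_block hk h0
  refine ⟨fun n => π (I n) (J n), fun i j hij => ?_⟩
  have h1 := hIJ (k i + j)
  have h2 := hlt (k i + j)
  have hi : I (k i + j) = i := by
    apply le_antisymm
    · by_contra hc
      have := hk.monotone (show i + 1 ≤ I (k i + j) by omega)
      omega
    · by_contra hc
      have := hk.monotone (show I (k i + j) + 1 ≤ i by omega)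
      omega
  rw [hi] at h1
  have hj : J (k i + j) = j := by omega
  simp only [hi, hj]

/-! ### Regrouping and factorizing infinite concatenations. -/

namespace Trace

variable {α : Type*}

theorem append_nil (w : Trace α) : append [] w = w := by
  apply get?_injective
  simp [get?_append]

/-- The finite word `u a ⬝ u (a + 1) ⬝ … ⬝ u (b - 1)`. -/
def segment (u : ℕ → List α) (a b : ℕ) : List α := partialCat (fun i => u (a + i)) (b - a)

theorem partialCat_append_segment (u : ℕ → List α) {a b : ℕ} (h : a ≤ b) :
    partialCat u a ++ segment u a b = partialCat u b := by
  rw [segment, ← partialCat_add, Nat.add_sub_cancel' h]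

theorem segment_append_segment (u : ℕ → List α) {a b c : ℕ} (h : a ≤ b) (h' : b ≤ c) :
    segment u a b ++ segment u b c = segment u a c := by
  apply List.append_cancel_left (as := partialCat u a)
  rw [← List.append_assoc, partialCat_append_segment u h, partialCat_append_segment u h',
    partialCat_append_segment u (h.trans h')]

theorem partialCat_segment (u : ℕ → List α) {k : ℕ → ℕ} (hk : Monotone k) (h0 : k 0 = 0) (n : ℕ) :
    partialCat (fun i => segment u (k i) (k (i + 1))) n = partialCat u (k n) := by
  induction n with
  | zero => simp [h0, partialCat]
  | succ n ih => rw [partialCat_succ, ih, partialCat_append_segment u (hk n.le_succ)]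

/-- Grouping the factors of an infinite concatenation. -/
theorem isInfCat_segment {u : ℕ → List α} {k : ℕ → ℕ} (hk : StrictMono k) (h0 : k 0 = 0)
    {w : Trace α} :
    IsInfCat (fun i => segment u (k i) (k (i + 1))) w ↔ IsInfCat u w := by
  have h : ∀ l : List α, (∃ n, l <+: partialCat (fun i => segment u (k i) (k (i + 1))) n) ↔
      ∃ n, l <+: partialCat u n := by
    intro l
    simp only [partialCat_segment u hk.monotone h0]
    exact ⟨fun ⟨n, hn⟩ => ⟨_, hn⟩,
      fun ⟨n, hn⟩ => ⟨n, hn.trans (partialCat_prefix u hk.le_apply)⟩⟩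
  simp only [IsInfCat, h]

theorem IsInfCat.unique {u : ℕ → List α} {v w : Trace α} (hv : IsInfCat u v) (hw : IsInfCat u w) :
    v = w :=
  (existsUnique_isInfCat u).unique hv hw

/-- Putting a finite word in front of an infinite concatenation. -/
theorem IsInfCat.cons {u : ℕ → List α} {w : Trace α} (hw : IsInfCat (fun i => u (i + 1)) w) :
    IsInfCat u (append (u 0) w) := by
  obtain ⟨v, hv, -⟩ := existsUnique_isInfCat u
  obtain ⟨r, rfl, hr⟩ := hv.drop 1
  have : (fun i => u (1 + i)) = fun i => u (i + 1) := funext fun i => by rw [add_comm]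
  rw [this] at hr
  rw [hw.unique hr]
  simpa [partialCat] using hv

theorem IsInfCat.tail {u : ℕ → List α} {w : Trace α} (hw : IsInfCat u w) :
    ∃ r, w = append (u 0) r ∧ IsInfCat (fun i => u (i + 1)) r := by
  obtain ⟨r, rfl, hr⟩ := hw.drop 1
  refine ⟨r, by simp [partialCat], ?_⟩
  convert hr using 3
  rw [add_comm]

theorem isInfCat_fin (w : List α) :
    IsInfCat (fun i => if i = 0 then w else []) (fin w) := by
  have h : ∀ n, partialCat (fun i => if i = 0 then w else []) (n + 1) = w := by
    intro n
    induction n with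
    | zero => simp [partialCat]
    | succ n ih => rw [partialCat_succ, ih]; simp
  intro l
  constructor
  · exact fun hl => ⟨1, by rw [h 0]; exact hl⟩
  · rintro ⟨n, hn⟩
    have := hn.trans (partialCat_prefix _ n.le_succ)
    rwa [h n] at this

theorem partialCat_singleton (s : ℕ → α) (n : ℕ) :
    partialCat (fun i => [s i]) n = (List.range n).map s := by
  induction n with
  | zero => rfl
  | succ n ih => rw [partialCat_succ, ih, List.range_succ, List.map_append]; rfl

theorem hasPrefix_inf_iff {l : List α} {s : ℕ → α} :
    HasPrefix l (inf s) ↔ l = (List.range l.length).map s := by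
  constructor
  · intro h
    apply List.ext_getElem (by simp)
    intro i h₁ h₂
    simpa using h i h₁
  · intro h i hi
    have : l[i]? = ((List.range l.length).map s)[i]? := by rw [← h]
    simpa [hi] using this

theorem isInfCat_inf (s : ℕ → α) : IsInfCat (fun i => [s i]) (inf s) := by
  intro l
  simp only [partialCat_singleton]
  constructor
  · exact fun h => ⟨l.length, by rw [← hasPrefix_inf_iff.1 h]⟩
  · rintro ⟨n, hn⟩
    refine HasPrefix.of_prefix hn ?_
    rw [hasPrefix_inf_iff]
    simp

theorem exists_isInfCat (w : Trace α) : ∃ u, IsInfCat u w := by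
  cases w with
  | fin w => exact ⟨_, isInfCat_fin w⟩
  | inf s => exact ⟨_, isInfCat_inf s⟩

theorem length_partialCat_strictMono {u : ℕ → List α} (hu : ∀ i, u i ≠ []) :
    StrictMono fun n => (partialCat u n).length := by
  apply strictMono_nat_of_lt_succ
  intro n
  rw [partialCat_succ, List.length_append]
  have := List.length_pos_iff.2 (hu n)
  omega

/-- An infinite concatenation of nonempty words is infinite. -/
theorem IsInfCat.eq_inf {u : ℕ → List α} {w : Trace α} (hw : IsInfCat u w) (hu : ∀ i, u i ≠ []) :
    ∃ s, w = inf s := by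
  cases w with
  | inf s => exact ⟨s, rfl⟩
  | fin w =>
    have h₁ : (partialCat u (w.length + 1)).length ≤ w.length :=
      List.IsPrefix.length_le (hw.hasPrefix (w.length + 1))
    have h₂ := (length_partialCat_strictMono hu).le_apply (x := w.length + 1)
    omega

end Trace

/-! ### Ramsey factorizations -/

/-- Ramsey's theorem for pairs of natural numbers and finitely many colours. -/
theorem exists_strictMono_monochromatic {β : Type*} [Finite β] (c : ℕ → ℕ → β) :
    ∃ (k : ℕ → ℕ) (b : β), StrictMono k ∧ ∀ i j, i < j → c (k i) (k j) = b := by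
  -- Fix a nonprincipal ultrafilter. Each row `c i` has one colour `d i` on a large set, and `d`
  -- itself has one colour `b` on a large set. Any finite set of indices of colour `b` then extends,
  -- because finitely many large sets meet.
  have key : ∀ φ : ℕ → β, ∃ b, ∀ᶠ j in (Filter.hyperfilter ℕ : Filter ℕ), φ j = b := by
    intro φ
    have h : ∀ᶠ j in (Filter.hyperfilter ℕ : Filter ℕ), ∃ b ∈ (Set.univ : Set β), φ j = b := by
      simp
    obtain ⟨b, -, hb⟩ := (Ultrafilter.eventually_exists_mem_iff Set.finite_univ).1 h
    exact ⟨b, hb⟩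
  choose d hd using fun i => key (c i)
  obtain ⟨b, hb⟩ := key d
  have hgt : ∀ n, ∀ᶠ j in (Filter.hyperfilter ℕ : Filter ℕ), n < j := fun n =>
    Filter.hyperfilter_le_cofinite (Nat.cofinite_eq_atTop ▸ Filter.eventually_gt_atTop n)
  obtain ⟨k, hk₁, hk₂⟩ := exists_seq_of_forall_finset_exists (fun i => d i = b)
    (fun i j => i < j ∧ c i j = b) (by
      intro s hs
      have h : ∀ᶠ j in (Filter.hyperfilter ℕ : Filter ℕ), ∀ i ∈ s, i < j ∧ c i j = b := by
        rw [Filter.eventually_all_finset]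
        intro i hi
        filter_upwards [hgt i, hd i] with j h₁ h₂
        exact ⟨h₁, h₂.trans (hs i hi)⟩
      exact (hb.and h).exists)
  exact ⟨k, b, fun i j hij => (hk₂ i j hij).1, fun i j hij => (hk₂ i j hij).2⟩

namespace ExtBuchi

open Trace

variable {Q Ev : Type*} (𝔄 : ExtBuchi Q Ev)

theorem cls_eq_cls_iff {w u : List Ev} :
    𝔄.cls w = 𝔄.cls u ↔ (w = [] ∧ u = []) ∨ (w ≠ [] ∧ u ≠ [] ∧ 𝔄.Sim w u) :=
  Con.eq _

theorem cls_nil : 𝔄.cls [] = 1 := rfl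

theorem cls_eq_one_iff {w : List Ev} : 𝔄.cls w = 1 ↔ w = [] := by
  rw [← cls_nil, cls_eq_cls_iff]
  simp

/-- Apart from the class of the empty word, a class is determined by its two reachability relations
on the finite set `Q`. The alphabet itself may be infinite. -/
instance finite_cls [Finite Q] : Finite 𝔄.Cls := by
  classical
  let φ : 𝔄.Cls → Prop × (Q → Q → Prop) × (Q → Q → Prop) := fun C =>
    (C = 1, fun p q => 𝔄.Reach p (𝔄.words_nonempty C).choose q,
      fun p q => 𝔄.ReachF p (𝔄.words_nonempty C).choose q)
  refine Finite.of_injective φ fun C D h => ?_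
  simp only [φ, Prod.mk.injEq, eq_iff_iff, funext_iff] at h
  by_cases hC : C = 1
  · rw [hC, h.1.1 hC]
  · have hD : D ≠ 1 := fun hD => hC (h.1.2 hD)
    have eC := (𝔄.words_nonempty C).choose_spec
    have eD := (𝔄.words_nonempty D).choose_spec
    rw [← eC, ← eD, cls_eq_cls_iff]
    refine .inr ⟨fun h' => hC ?_, fun h' => hD ?_, fun p q => ⟨h.2.1 p q, h.2.2 p q⟩⟩
    · rw [← eC, h', cls_nil]
    · rw [← eD, h', cls_nil]

theorem cls_partialCat_congr {u v : ℕ → List Ev} (h : ∀ i, 𝔄.cls (u i) = 𝔄.cls (v i)) (n : ℕ) :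
    𝔄.cls (partialCat u n) = 𝔄.cls (partialCat v n) := by
  induction n with
  | zero => rfl
  | succ n ih => rw [partialCat_succ, partialCat_succ, cls_append, cls_append, ih, h]

/-- Two infinite concatenations with equivalent factors share a lasso. -/
theorem exists_lasso [Finite Q] {u v : ℕ → List Ev} (h : ∀ i, 𝔄.cls (u i) = 𝔄.cls (v i))
    {w z : Trace Ev} (hw : IsInfCat u w) (hz : IsInfCat v z) :
    ∃ p : 𝔄.LPair, w ∈ 𝔄.lasso p ∧ z ∈ 𝔄.lasso p := by
  obtain ⟨k, D, hk, hD⟩ := exists_strictMono_monochromatic fun a b => 𝔄.cls (segment u a b)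
  have hDD : D * D = D := by
    have h := congrArg 𝔄.cls (segment_append_segment u (hk (show 0 < 1 by simp)).le
      (hk (show 1 < 2 by simp)).le)
    rwa [cls_append, hD 0 1 (by simp), hD 1 2 (by simp), hD 0 2 (by simp)] at h
  -- The stem ends at `k 1` rather than `k 0`: its last block then has class `D`, and idempotency of
  -- `D` gives `C * D = C`.
  have hC : 𝔄.cls (partialCat u (k 1)) * D = 𝔄.cls (partialCat u (k 1)) := by
    rw [← partialCat_append_segment u (hk (show 0 < 1 by simp)).le, cls_append, hD 0 1 (by simp),
      mul_assoc, hDD]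
  refine ⟨⟨(𝔄.cls (partialCat u (k 1)), D), hC, hDD⟩, ?_⟩
  have key : ∀ {v : ℕ → List Ev} {z : Trace Ev}, (∀ i, 𝔄.cls (u i) = 𝔄.cls (v i)) →
      IsInfCat v z → z ∈ 𝔄.lasso ⟨(𝔄.cls (partialCat u (k 1)), D), hC, hDD⟩ := by
    intro v z hv hz
    obtain ⟨r, rfl, hr⟩ := hz.drop (k 1)
    refine ⟨_, (𝔄.cls_partialCat_congr hv _).symm, r,
      ⟨fun i => segment v (k (i + 1)) (k (i + 2)), fun i => ?_, ?_⟩, rfl⟩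
    · exact (𝔄.cls_partialCat_congr (fun i => (hv _).symm) _).trans
        (hD (i + 1) (i + 2) (by omega))
    -- After the first `k 1` factors are dropped, the cut positions must be shifted so that they
    -- start at `0`.
    · have hk' : StrictMono fun i => k (i + 1) - k 1 := fun i j hij => by
        have h₁ := hk (show i + 1 < j + 1 by omega)
        have h₂ := hk.monotone (show 1 ≤ i + 1 by omega)
        simp only
        omega
      rw [← isInfCat_segment hk' (by simp)] at hr
      convert hr using 2 with i
      have h₁ := hk.monotone (show 1 ≤ i + 1 by omega)
      have h₂ := hk.monotone (show 1 ≤ i + 2 by omega)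
      simp only [Trace.segment]
      congr 1
      · funext j
        congr 1
        omega
      · show _ = (k (i + 1 + 1) - k 1) - _
        have : i + 1 + 1 = i + 2 := rfl
        rw [this]
        omega
  exact ⟨key (fun _ => rfl) hw, key h hz⟩

/-- Every trace lies in some lasso. -/
theorem exists_mem_lasso [Finite Q] (w : Trace Ev) : ∃ p : 𝔄.LPair, w ∈ 𝔄.lasso p := by
  obtain ⟨u, hu⟩ := exists_isInfCat w
  obtain ⟨p, hp, -⟩ := 𝔄.exists_lasso (fun _ => rfl) hu hu
  exact ⟨p, hp⟩

/-! ### The abstraction as a least closed set -/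

/-- The sets of pairs that are closed under sharing a trace: these form `ℳ_{≤ω}`. -/
def IsClosedSet (𝒱 : Set 𝔄.LPair) : Prop :=
  ∀ p q, q ∈ 𝒱 → (𝔄.lasso p ∩ 𝔄.lasso q).Nonempty → p ∈ 𝒱

theorem isClosedSet (𝒱 : 𝔄.MOmega) : 𝔄.IsClosedSet 𝒱.1 := 𝔄.mem_MOmega_iff.1 𝒱.2

theorem preAbs_subset_alphaOmega (V : Set (Trace Ev)) : 𝔄.preAbs V ⊆ (𝔄.alphaOmega V).1 := by
  intro p hp
  refine Set.mem_iUnion.2 ⟨0, 𝔄.mem_preAbs_preConc.2 ⟨p, hp, ?_⟩⟩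
  simpa using 𝔄.lasso_nonempty p

theorem mem_alphaOmega {V : Set (Trace Ev)} {p : 𝔄.LPair} {w : Trace Ev} (hp : w ∈ 𝔄.lasso p)
    (hw : w ∈ V) : p ∈ (𝔄.alphaOmega V).1 :=
  𝔄.preAbs_subset_alphaOmega V ⟨w, hp, hw⟩

/-- A closed set containing `preAbs V` absorbs each application of `preAbs ∘ preConc`, hence all
iterates. Thus `alphaOmega V` is the least closed set above `preAbs V`. -/
theorem alphaOmega_subset_of_preAbs {V : Set (Trace Ev)} {𝒱 : Set 𝔄.LPair}
    (h𝒱 : 𝔄.IsClosedSet 𝒱) (h : 𝔄.preAbs V ⊆ 𝒱) : (𝔄.alphaOmega V).1 ⊆ 𝒱 := by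
  have : ∀ n, (fun 𝒲 => 𝔄.preAbs (𝔄.preConc 𝒲))^[n] (𝔄.preAbs V) ⊆ 𝒱 := by
    intro n
    induction n with
    | zero => exact h
    | succ n ih =>
      rw [Function.iterate_succ_apply']
      intro p hp
      obtain ⟨q, hq, hpq⟩ := 𝔄.mem_preAbs_preConc.1 hp
      exact h𝒱 p q (ih hq) hpq
  exact Set.iUnion_subset fun n => this (n + 1)

/-- The abstraction of `V` lies in a closed set once every trace of `V` is covered by it. -/
theorem alphaOmega_subset {V : Set (Trace Ev)} {𝒱 : Set 𝔄.LPair}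
    (h𝒱 : 𝔄.IsClosedSet 𝒱) (h : ∀ v ∈ V, ∃ p ∈ 𝒱, v ∈ 𝔄.lasso p) : (𝔄.alphaOmega V).1 ⊆ 𝒱 := by
  refine 𝔄.alphaOmega_subset_of_preAbs h𝒱 ?_
  rintro p ⟨v, hp, hv⟩
  obtain ⟨q, hq, hvq⟩ := h v hv
  exact h𝒱 p q hq ⟨v, hp, hvq⟩

theorem alphaOmega_mono {V W : Set (Trace Ev)} (h : V ⊆ W) :
    (𝔄.alphaOmega V).1 ⊆ (𝔄.alphaOmega W).1 :=
  𝔄.alphaOmega_subset_of_preAbs (𝔄.isClosedSet _)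
    fun _ ⟨_, hp, hv⟩ => 𝔄.mem_alphaOmega hp (h hv)

theorem alphaOmega_empty : 𝔄.alphaOmega ∅ = 𝔄.omegaEmpty :=
  Subtype.ext <| Set.Subset.antisymm
    (𝔄.alphaOmega_subset_of_preAbs (𝔄.isClosedSet 𝔄.omegaEmpty) fun _ ⟨_, _, hv⟩ => hv.elim)
    (Set.empty_subset _)

theorem alphaOmega_union (V W : Set (Trace Ev)) :
    𝔄.alphaOmega (V ∪ W) = 𝔄.omegaUnion (𝔄.alphaOmega V) (𝔄.alphaOmega W) := by
  refine Subtype.ext (Set.Subset.antisymm ?_ (Set.union_subset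
    (𝔄.alphaOmega_mono Set.subset_union_left) (𝔄.alphaOmega_mono Set.subset_union_right)))
  refine 𝔄.alphaOmega_subset_of_preAbs (𝔄.isClosedSet (𝔄.omegaUnion _ _)) ?_
  rintro p ⟨v, hp, hv | hv⟩
  · exact .inl (𝔄.mem_alphaOmega hp hv)
  · exact .inr (𝔄.mem_alphaOmega hp hv)

/-! ### Exactness of the abstraction for concatenation and iteration. -/

/-- The pair `(AC, D)`. -/
def mulPair (A : 𝔄.Cls) (p : 𝔄.LPair) : 𝔄.LPair :=
  ⟨(A * p.1.1, p.1.2), by rw [mul_assoc, p.2.1], p.2.2⟩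

theorem append_mem_lasso_mulPair {a : List Ev} {w : Trace Ev} {p : 𝔄.LPair} (hw : w ∈ 𝔄.lasso p) :
    append a w ∈ 𝔄.lasso (𝔄.mulPair (𝔄.cls a) p) := by
  obtain ⟨c, hc, t, ht, rfl⟩ := hw
  refine ⟨a ++ c, ?_, t, ht, (append_append _ _ _).symm⟩
  simp only [words, Set.mem_ofPred_eq] at hc ⊢
  rw [cls_append, hc]
  rfl

theorem mem_alphaStar {U : Set (List Ev)} {C : 𝔄.Cls} :
    C ∈ 𝔄.alphaStar U ↔ ∃ w ∈ U, 𝔄.cls w = C :=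
  ⟨fun ⟨w, h₁, h₂⟩ => ⟨w, h₂, h₁⟩, fun ⟨w, h₁, h₂⟩ => ⟨w, h₂, h₁⟩⟩

/-- From left to right, a lasso around `v` becomes one around `a ⬝ v` by multiplying its stem by the
class of `a`. Conversely, for fixed `a`, the pairs that this multiplication sends into the left side
form a closed set containing `preAbs V`, so minimality of `alphaOmega V` applies. -/
theorem alphaOmega_catSet [Finite Q] (U : Set (List Ev)) (V : Set (Trace Ev)) :
    𝔄.alphaOmega (catSet U V) = 𝔄.omegaCat (𝔄.alphaStar U) (𝔄.alphaOmega V) := by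
  refine Subtype.ext (Set.Subset.antisymm ?_ ?_)
  · refine 𝔄.alphaOmega_subset (𝔄.isClosedSet (𝔄.omegaCat _ _)) ?_
    rintro _ ⟨a, ha, v, hv, rfl⟩
    obtain ⟨q, hq⟩ := 𝔄.exists_mem_lasso v
    exact ⟨𝔄.mulPair (𝔄.cls a) q, ⟨𝔄.cls a, 𝔄.mem_alphaStar.2 ⟨a, ha, rfl⟩, q,
      𝔄.mem_alphaOmega hq hv, rfl, rfl⟩, 𝔄.append_mem_lasso_mulPair hq⟩
  · rintro p ⟨A, hA, q, hq, h₁, h₂⟩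
    obtain rfl : p = 𝔄.mulPair A q := Subtype.ext (Prod.ext h₁ h₂)
    obtain ⟨a, ha, rfl⟩ := 𝔄.mem_alphaStar.1 hA
    refine 𝔄.alphaOmega_subset_of_preAbs
      (𝒱 := {q | 𝔄.mulPair (𝔄.cls a) q ∈ (𝔄.alphaOmega (catSet U V)).1}) ?_ ?_ hq
    · rintro r r' hr' ⟨w, hw, hw'⟩
      exact 𝔄.isClosedSet (𝔄.alphaOmega (catSet U V)) _ _ hr' ⟨append a w, 𝔄.append_mem_lasso_mulPair hw,
        𝔄.append_mem_lasso_mulPair hw'⟩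
    · rintro r ⟨v, hr, hv⟩
      exact 𝔄.mem_alphaOmega (𝔄.append_mem_lasso_mulPair hr) ⟨a, ha, v, hv, rfl⟩

theorem mem_gammaStar_alphaStar {U : Set (List Ev)} {w : List Ev} :
    w ∈ 𝔄.gammaStar (𝔄.alphaStar U) ↔ ∃ u ∈ U, 𝔄.cls u = 𝔄.cls w := by
  simp [gammaStar, words, mem_alphaStar, eq_comm]

/-- Passing to classes before iterating costs nothing: replacing each factor by an equivalent one
from `U` yields a trace in `omegaPow U` that shares a lasso with the original. -/
theorem omegaIter_alphaStar [Finite Q] (U : Set (List Ev)) :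
    𝔄.omegaIter (𝔄.alphaStar U) = 𝔄.alphaOmega (omegaPow U) := by
  refine Subtype.ext (Set.Subset.antisymm ?_ (𝔄.alphaOmega_mono ?_))
  · refine 𝔄.alphaOmega_subset (𝔄.isClosedSet _) ?_
    rintro w ⟨v, hv, hw⟩
    choose u hu huv using fun i => 𝔄.mem_gammaStar_alphaStar.1 (hv i)
    obtain ⟨z, hz, -⟩ := existsUnique_isInfCat u
    obtain ⟨p, hwp, hzp⟩ := 𝔄.exists_lasso (fun i => (huv i).symm) hw hz
    exact ⟨p, 𝔄.mem_alphaOmega hzp ⟨u, hu, hz⟩, hwp⟩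
  · rintro w ⟨u, hu, hw⟩
    exact ⟨u, fun i => 𝔄.mem_gammaStar_alphaStar.2 ⟨_, hu i, rfl⟩, hw⟩

theorem alphaStar_union (U V : Set (List Ev)) :
    𝔄.alphaStar (U ∪ V) = 𝔄.alphaStar U ∪ 𝔄.alphaStar V := by
  ext C
  simp only [Set.mem_union, mem_alphaStar]
  grind

theorem alphaStar_image2 (U V : Set (List Ev)) :
    𝔄.alphaStar (Set.image2 (· ++ ·) U V) = 𝔄.starCat (𝔄.alphaStar U) (𝔄.alphaStar V) := by
  ext C
  simp only [starCat, Set.mem_ofPred_eq, mem_alphaStar, Set.mem_image2]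
  constructor
  · rintro ⟨_, ⟨a, ha, b, hb, rfl⟩, rfl⟩
    exact ⟨_, ⟨a, ha, rfl⟩, _, ⟨b, hb, rfl⟩, 𝔄.cls_append a b⟩
  · rintro ⟨_, ⟨a, ha, rfl⟩, _, ⟨b, hb, rfl⟩, rfl⟩
    exact ⟨_, ⟨a, ha, b, hb, rfl⟩, 𝔄.cls_append a b⟩

/-- All finite concatenations of members of `U`. -/
def starLang (U : Set (List Ev)) : Set (List Ev) :=
  {w | ∃ l : List (List Ev), (∀ y ∈ l, y ∈ U) ∧ w = l.flatten}

theorem nil_mem_starLang (U : Set (List Ev)) : [] ∈ starLang U := ⟨[], by simp, rfl⟩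

theorem append_mem_starLang {U : Set (List Ev)} {u w : List Ev} (hu : u ∈ U)
    (hw : w ∈ starLang U) : u ++ w ∈ starLang U := by
  obtain ⟨l, hl, rfl⟩ := hw
  exact ⟨u :: l, by simpa using ⟨hu, hl⟩, rfl⟩

theorem starLang_induction {U : Set (List Ev)} {p : List Ev → Prop} (nil : p [])
    (append : ∀ u ∈ U, ∀ w, p w → p (u ++ w)) {w : List Ev} (hw : w ∈ starLang U) : p w := by
  obtain ⟨l, hl, rfl⟩ := hw
  induction l with
  | nil => exact nil
  | cons u l ih =>
    exact append u (hl u (by simp)) _ (ih fun y hy => hl y (by simp [hy]))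

theorem alphaStar_starLang (U : Set (List Ev)) :
    𝔄.alphaStar (starLang U) = 𝔄.starIter (𝔄.alphaStar U) := by
  ext C
  rw [mem_alphaStar]
  constructor
  · rintro ⟨w, hw, rfl⟩
    refine starLang_induction (p := fun w => 𝔄.cls w ∈ 𝔄.starIter (𝔄.alphaStar U))
      (Submonoid.one_mem _) (fun u hu w ih => ?_) hw
    exact Submonoid.mul_mem _ (Submonoid.subset_closure (𝔄.mem_alphaStar.2 ⟨u, hu, rfl⟩)) ih
  · intro hC
    refine Submonoid.closure_induction_left
      (motive := fun C _ => ∃ w ∈ starLang U, 𝔄.cls w = C) ⟨[], nil_mem_starLang U, rfl⟩ ?_ hC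
    rintro A hA _ - ⟨w, hw, rfl⟩
    obtain ⟨u, hu, rfl⟩ := 𝔄.mem_alphaStar.1 hA
    exact ⟨u ++ w, append_mem_starLang hu hw, 𝔄.cls_append u w⟩

end ExtBuchi

end BuchiEffect

namespace BuchiEffect

/-! ### Saturation of the language of an automaton -/

namespace ExtBuchi

open Trace

variable {Q Ev : Type*} (𝔄 : ExtBuchi Q Ev)

theorem Reach.exists_path {p q : Q} {w : List Ev} (h : 𝔄.Reach p w q) :
    ∃ π : ℕ → Q, π 0 = p ∧ π w.length = q ∧ ∀ j (hj : j < w.length), π (j + 1) ∈ 𝔄.δ (π j) w[j] := by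
  induction w generalizing p with
  | nil => exact ⟨fun _ => p, rfl, h, by simp⟩
  | cons a w ih =>
    obtain ⟨r, hr, h⟩ := h
    obtain ⟨π, h0, h1, h2⟩ := ih h
    refine ⟨fun n => n.casesOn p π, rfl, h1, fun j hj => ?_⟩
    cases j with
    | zero => simpa [h0] using hr
    | succ j => simpa using h2 j (by simpa using hj)

theorem ReachF.exists_path {p q : Q} {w : List Ev} (h : 𝔄.ReachF p w q) :
    ∃ π : ℕ → Q, π 0 = p ∧ π w.length = q ∧
      (∀ j (hj : j < w.length), π (j + 1) ∈ 𝔄.δ (π j) w[j]) ∧ ∃ j ≤ w.length, π j ∈ 𝔄.F := by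
  obtain ⟨r, hr, u, v, rfl, h₁, h₂⟩ := h
  obtain ⟨π, a0, a1, a2⟩ := Reach.exists_path 𝔄 h₁
  obtain ⟨σ, b0, b1, b2⟩ := Reach.exists_path 𝔄 h₂
  refine ⟨fun n => if n ≤ u.length then π n else σ (n - u.length), by simp [a0], ?_, ?_,
    u.length, by simp, by simpa [a1] using hr⟩
  · simp only [List.length_append]
    split_ifs with hv
    · obtain rfl : v = [] := List.length_eq_zero_iff.1 (by omega)
      simp only [List.length_nil, add_zero] at b1 ⊢
      rw [a1, ← b1, b0]
    · simpa using b1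
  · intro j hj
    simp only [List.length_append] at hj
    rcases lt_trichotomy j u.length with h | h | h
    · simpa [h, h.le, Nat.succ_le_of_lt h] using a2 j h
    · have := b2 0 (by omega)
      simp only [h, le_refl, if_true, a1, ← b0]
      simpa using this
    · have := b2 (j - u.length) (by omega)
      have e : j + 1 - u.length = j - u.length + 1 := by omega
      simp only [show ¬ j ≤ u.length by omega, show ¬ j + 1 ≤ u.length by omega, if_false, e]
      rw [List.getElem_append_right (by omega)]
      exact this

theorem reach_of_path {ρ : ℕ → Q} {w : List Ev} {a : ℕ}
    (h : ∀ j (hj : j < w.length), ρ (a + j + 1) ∈ 𝔄.δ (ρ (a + j)) w[j]) :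
    𝔄.Reach (ρ a) w (ρ (a + w.length)) := by
  induction w generalizing a with
  | nil => rfl
  | cons x w ih =>
    refine ⟨ρ (a + 1), h 0 (by simp), ?_⟩
    have := ih (a := a + 1) fun j hj => by
      have := h (j + 1) (by simpa using hj)
      simpa [add_assoc, add_comm, add_left_comm] using this
    simpa [add_assoc, add_comm, add_left_comm] using this

theorem reachF_of_path {ρ : ℕ → Q} {w : List Ev} {a : ℕ}
    (h : ∀ j (hj : j < w.length), ρ (a + j + 1) ∈ 𝔄.δ (ρ (a + j)) w[j])
    {j : ℕ} (hj : j ≤ w.length) (hF : ρ (a + j) ∈ 𝔄.F) :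
    𝔄.ReachF (ρ a) w (ρ (a + w.length)) := by
  refine ⟨_, hF, w.take j, w.drop j, (List.take_append_drop j w).symm, ?_, ?_⟩
  · have := 𝔄.reach_of_path (ρ := ρ) (w := w.take j) (a := a) fun i hi => by
      simpa using h i (by simp at hi; omega)
    simpa [hj] using this
  · have := 𝔄.reach_of_path (ρ := ρ) (w := w.drop j) (a := a + j) fun i hi => by
      simpa [add_assoc] using h (j + i) (by simp at hi; omega)
    have e : a + j + (w.length - j) = a + w.length := by omega
    simpa [e] using this

theorem length_partialCat_succ {α : Type*} (u : ℕ → List α) (n : ℕ) :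
    (partialCat u (n + 1)).length = (partialCat u n).length + (u n).length := by
  rw [partialCat_succ, List.length_append]

theorem getElem_of_isInfCat {α : Type*} {u : ℕ → List α} {s : ℕ → α} (h : IsInfCat u (.inf s))
    (i j : ℕ) (hj : j < (u i).length) : (u i)[j] = s ((partialCat u i).length + j) := by
  have := h.hasPrefix (i + 1) ((partialCat u i).length + j)
    (by rw [length_partialCat_succ]; omega)
  simpa [partialCat_succ] using this

/-- Büchi acceptance in terms of a factorization into nonempty words. -/
theorem accepts_iff_of_isInfCat {u : ℕ → List Ev} {w : Trace Ev} (hw : IsInfCat u w)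
    (hu : ∀ i, u i ≠ []) :
    𝔄.Accepts w ↔ ∃ p : ℕ → Q, p 0 = 𝔄.q₀ ∧ (∀ i, 𝔄.Reach (p i) (u i) (p (i + 1))) ∧
      ∀ n, ∃ m, n ≤ m ∧ 𝔄.ReachF (p m) (u m) (p (m + 1)) := by
  obtain ⟨s, rfl⟩ := hw.eq_inf hu
  have hk := length_partialCat_strictMono hu
  have hs := length_partialCat_succ u
  have hget := getElem_of_isInfCat hw
  have h0 : (partialCat u 0).length = 0 := rfl
  generalize hK : (fun n => (partialCat u n).length) = k at hk
  have hk' : ∀ n, (partialCat u n).length = k n := fun n => congrFun hK n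
  simp only [hk'] at hs hget h0
  constructor
  · rintro ⟨ρ, hρ0, hρ, hF⟩
    have hpath : ∀ i j (hj : j < (u i).length), ρ (k i + j + 1) ∈ 𝔄.δ (ρ (k i + j)) (u i)[j] :=
      fun i j hj => by rw [hget]; exact hρ _
    refine ⟨fun i => ρ (k i), by simp [h0, hρ0], fun i => ?_, fun n => ?_⟩
    · simp only [hs]
      exact 𝔄.reach_of_path (hpath i)
    · obtain ⟨m, hm, hmF⟩ := hF (k n)
      obtain ⟨i, j, rfl, hlt⟩ := exists_block hk h0 m
      refine ⟨i, ?_, ?_⟩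
      · by_contra hc
        have := hk.monotone (show i + 1 ≤ n by omega)
        omega
      · simp only [hs]
        exact 𝔄.reachF_of_path (hpath i) (by rw [hs] at hlt; omega) hmF
  · rintro ⟨p, hp0, hp, hF⟩
    -- The path for a block is chosen to visit `F` whenever the block admits such a path; infinitely
    -- many blocks do.
    have hπ : ∀ i, ∃ π : ℕ → Q, π 0 = p i ∧ π (u i).length = p (i + 1) ∧
        (∀ j (hj : j < (u i).length), π (j + 1) ∈ 𝔄.δ (π j) (u i)[j]) ∧
        (𝔄.ReachF (p i) (u i) (p (i + 1)) → ∃ j ≤ (u i).length, π j ∈ 𝔄.F) := by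
      intro i
      by_cases h : 𝔄.ReachF (p i) (u i) (p (i + 1))
      · obtain ⟨π, h₁, h₂, h₃, h₄⟩ := ReachF.exists_path 𝔄 h
        exact ⟨π, h₁, h₂, h₃, fun _ => h₄⟩
      · obtain ⟨π, h₁, h₂, h₃⟩ := Reach.exists_path 𝔄 (hp i)
        exact ⟨π, h₁, h₂, h₃, fun h' => absurd h' h⟩
    choose π π0 π1 πδ πF using hπ
    obtain ⟨ρ, hρ⟩ := exists_glue hk h0 π
    -- The right end of a block is the left end of the next one, and both local paths have the state
    -- `p (i + 1)` there.
    have hρ' : ∀ i j, j ≤ (u i).length → ρ (k i + j) = π i j := by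
      intro i j hj
      rcases hj.lt_or_eq with h | rfl
      · exact hρ i j (by rw [hs]; omega)
      · rw [← hs, π1, ← π0]
        exact hρ (i + 1) 0 (hk (Nat.lt_succ_self _))
    refine ⟨ρ, ?_, fun n => ?_, fun n => ?_⟩
    · rw [← hp0, ← π0, ← hρ' 0 0 (Nat.zero_le _), h0]
    · obtain ⟨i, j, rfl, hlt⟩ := exists_block hk h0 n
      rw [hs] at hlt
      rw [← hget i j (by omega), add_assoc, hρ' i (j + 1) (by omega), hρ' i j (by omega)]
      exact πδ i j _
    · obtain ⟨m, hm, hmF⟩ := hF n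
      obtain ⟨j, hj, hjF⟩ := πF m hmF
      exact ⟨k m + j, le_trans (hm.trans hk.le_apply) (Nat.le_add_right _ _), by rwa [hρ' m j hj]⟩

theorem reach_iff_of_cls {w u : List Ev} (h : 𝔄.cls w = 𝔄.cls u) (p q : Q) :
    (𝔄.Reach p w q ↔ 𝔄.Reach p u q) ∧ (𝔄.ReachF p w q ↔ 𝔄.ReachF p u q) := by
  rcases 𝔄.cls_eq_cls_iff.1 h with ⟨rfl, rfl⟩ | ⟨-, -, h⟩
  · exact ⟨Iff.rfl, Iff.rfl⟩
  · exact h p q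

theorem accepts_fin_congr {w u : List Ev} (h : 𝔄.cls w = 𝔄.cls u) :
    𝔄.Accepts (.fin w) ↔ 𝔄.Accepts (.fin u) := by
  simp only [Accepts, (𝔄.reach_iff_of_cls h _ _).1]

/-- A lasso whose period is the class of the empty word consists of finite words. -/
theorem exists_fin_of_mem_lasso {p : 𝔄.LPair} (hp : p.1.2 = 1) {w : Trace Ev}
    (hw : w ∈ 𝔄.lasso p) : ∃ c, 𝔄.cls c = p.1.1 ∧ w = .fin c := by
  obtain ⟨c, hc, t, ⟨d, hd, ht⟩, rfl⟩ := hw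
  have hd' : d = fun i => if i = 0 then [] else [] := by
    funext i
    have := hd i
    rw [words, Set.mem_ofPred_eq, hp, cls_eq_one_iff] at this
    simp [this]
  subst hd'
  refine ⟨c, hc, ?_⟩
  rw [ht.unique (isInfCat_fin [])]
  simp [append]

/-- A lasso with nontrivial period consists of concatenations of nonempty words. -/
theorem exists_isInfCat_of_mem_lasso {p : 𝔄.LPair} (hp : p.1.2 ≠ 1) {w : Trace Ev}
    (hw : w ∈ 𝔄.lasso p) : ∃ u, IsInfCat u w ∧ (∀ i, u i ≠ []) ∧ 𝔄.cls (u 0) = p.1.1 ∧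
      ∀ i, 𝔄.cls (u (i + 1)) = p.1.2 := by
  obtain ⟨c, hc, t, ⟨d, hd, ht⟩, rfl⟩ := hw
  have hd' : ∀ i, d i ≠ [] := fun i h => hp (by rw [← hd i, h, cls_nil])
  obtain ⟨r, rfl, hr⟩ := ht.tail
  -- The stem `c` may be empty, so it is merged with the nonempty first period; its class is
  -- unchanged since `C * D = C`.
  refine ⟨fun i => if i = 0 then c ++ d 0 else d i, ?_, fun i => ?_, ?_, fun i => ?_⟩
  · have := IsInfCat.cons (u := fun i => if i = 0 then c ++ d 0 else d i) (w := r) (by simpa using hr)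
    rw [← append_append]
    simpa using this
  · dsimp only
    split_ifs
    · simp [hd' 0]
    · exact hd' i
  · have h₁ : 𝔄.cls c = p.1.1 := hc
    have h₂ : 𝔄.cls (d 0) = p.1.2 := hd 0
    simp [cls_append, h₁, h₂, p.2.1]
  · exact hd (i + 1)

/-- Each lasso is contained in the language or disjoint from it. -/
theorem accepts_congr_of_mem_lasso {p : 𝔄.LPair} {w z : Trace Ev} (hw : w ∈ 𝔄.lasso p)
    (hz : z ∈ 𝔄.lasso p) : 𝔄.Accepts w ↔ 𝔄.Accepts z := by
  by_cases hp : p.1.2 = 1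
  · obtain ⟨c, hc, rfl⟩ := 𝔄.exists_fin_of_mem_lasso hp hw
    obtain ⟨c', hc', rfl⟩ := 𝔄.exists_fin_of_mem_lasso hp hz
    exact 𝔄.accepts_fin_congr (hc.trans hc'.symm)
  · obtain ⟨u, h₁, h₂, h₃, h₄⟩ := 𝔄.exists_isInfCat_of_mem_lasso hp hw
    obtain ⟨v, k₁, k₂, k₃, k₄⟩ := 𝔄.exists_isInfCat_of_mem_lasso hp hz
    have h : ∀ i, 𝔄.cls (u i) = 𝔄.cls (v i) := by
      rintro (_ | i)
      · rw [h₃, k₃]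
      · rw [h₄, k₄]
    rw [𝔄.accepts_iff_of_isInfCat h₁ h₂, 𝔄.accepts_iff_of_isInfCat k₁ k₂]
    simp only [(𝔄.reach_iff_of_cls (h _) _ _).1, (𝔄.reach_iff_of_cls (h _) _ _).2]

theorem gammaStar_alphaStar_subset_lang (U : Set (List Ev)) :
    Trace.fin '' 𝔄.gammaStar (𝔄.alphaStar U) ⊆ 𝔄.lang ↔ Trace.fin '' U ⊆ 𝔄.lang := by
  simp only [Set.image_subset_iff]
  constructor
  · exact fun h u hu => h (𝔄.mem_gammaStar_alphaStar.2 ⟨u, hu, rfl⟩)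
  · intro h w hw
    obtain ⟨u, hu, huw⟩ := 𝔄.mem_gammaStar_alphaStar.1 hw
    exact (𝔄.accepts_fin_congr huw).1 (h hu)

/-- The pairs whose lasso lies in the language form a closed set, because a lasso meeting the
language is contained in it. Conversely, every trace of `V` lies in a lasso of its abstraction. -/
theorem gammaOmega_alphaOmega_subset_lang [Finite Q] (V : Set (Trace Ev)) :
    𝔄.gammaOmega (𝔄.alphaOmega V) ⊆ 𝔄.lang ↔ V ⊆ 𝔄.lang := by
  constructor
  · intro h v hv
    obtain ⟨p, hp⟩ := 𝔄.exists_mem_lasso v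
    exact h (Set.mem_biUnion (𝔄.mem_alphaOmega hp hv) hp)
  · intro h
    refine Set.iUnion₂_subset (𝔄.alphaOmega_subset_of_preAbs (𝒱 := {p | 𝔄.lasso p ⊆ 𝔄.lang}) ?_ ?_)
    · rintro p q hq ⟨w, hwp, hwq⟩ z hz
      exact (𝔄.accepts_congr_of_mem_lasso hwp hz).1 (hq hwq)
    · rintro p ⟨v, hvp, hv⟩ z hz
      exact (𝔄.accepts_congr_of_mem_lasso hvp hz).1 (h hv)

end ExtBuchi

end BuchiEffect

namespace BuchiEffect

/-! ### Nonterminating executions as infinite chains of calls -/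

namespace Trace

variable {α : Type*}

theorem partialCat_succ' (u : ℕ → List α) (n : ℕ) :
    partialCat u (n + 1) = u 0 ++ partialCat (fun i => u (i + 1)) n := by
  rw [add_comm n 1, partialCat_add]
  simp [partialCat, add_comm]

theorem partialCat_congr {u v : ℕ → List α} {n : ℕ} (h : ∀ i < n, u i = v i) :
    partialCat u n = partialCat v n := by
  induction n with
  | zero => rfl
  | succ n ih => rw [partialCat_succ, partialCat_succ, ih fun i hi => h i (by omega), h n (by omega)]

/-- The prefix of length `n` of an infinite word. -/
def initial (s : ℕ → α) (n : ℕ) : List α := (List.range n).map s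

theorem length_initial (s : ℕ → α) (n : ℕ) : (initial s n).length = n := by simp [initial]

theorem initial_add (s : ℕ → α) (m n : ℕ) :
    initial s (m + n) = initial s m ++ initial (fun i => s (m + i)) n := by
  simp [initial, List.range_add]

theorem initial_isPrefix (s : ℕ → α) {m n : ℕ} (h : m ≤ n) : initial s m <+: initial s n := by
  obtain ⟨k, rfl⟩ := Nat.exists_eq_add_of_le h
  rw [initial_add]
  exact List.prefix_append _ _

theorem eq_initial_of_append_eq {s : ℕ → α} {n : ℕ} {a b : List α} (h : a ++ b = initial s n) :
    a = initial s a.length ∧ b = initial (fun i => s (a.length + i)) b.length := by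
  have hn : n = a.length + b.length := by rw [← length_initial s n, ← h, List.length_append]
  rw [hn, initial_add] at h
  exact List.append_inj h (length_initial _ _).symm

theorem reduceOption_initial (s : ℕ → Option α) (n : ℕ) :
    (initial s n).reduceOption = partialCat (fun i => (s i).toList) n := by
  induction n with
  | zero => rfl
  | succ n ih =>
    rw [partialCat_succ, ← ih, initial_add, List.reduceOption_append]
    cases h : s n <;> simp [initial, h, List.reduceOption]

end Trace

section Semantics

open Trace

variable {Ev Proc : Type*} {P : Program Ev Proc}

/-! ### Compositional description of terminating traces and of calls. -/

theorem termTrace_out {a : Ev} {w : List Ev} : TermTrace P (.out a) w ↔ w = [a] := by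
  constructor
  · rintro ⟨_, ⟨⟩, rfl⟩
    rfl
  · rintro rfl
    exact ⟨_, .out a, rfl⟩

theorem termTrace_call {f : Proc} {w : List Ev} :
    TermTrace P (.call f) w ↔ TermTrace P (P f) w := by
  constructor
  · rintro ⟨_, @⟨⟩, rfl⟩
    rename_i w h
    exact ⟨w, h, rfl⟩
  · rintro ⟨w, h, rfl⟩
    exact ⟨_, .call h, rfl⟩

theorem termTrace_seq {e₁ e₂ : Expr Ev Proc} {w : List Ev} :
    TermTrace P (.seq e₁ e₂) w ↔ ∃ a, TermTrace P e₁ a ∧ ∃ b, TermTrace P e₂ b ∧ a ++ b = w := by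
  constructor
  · rintro ⟨_, @⟨⟩, rfl⟩
    rename_i a b ha hb
    exact ⟨_, ⟨a, ha, rfl⟩, _, ⟨b, hb, rfl⟩, (List.reduceOption_append _ _).symm⟩
  · rintro ⟨_, ⟨a, ha, rfl⟩, _, ⟨b, hb, rfl⟩, rfl⟩
    exact ⟨_, .seq ha hb, (List.reduceOption_append _ _).symm⟩

theorem termTrace_choice {e₁ e₂ : Expr Ev Proc} {w : List Ev} :
    TermTrace P (.choice e₁ e₂) w ↔ TermTrace P e₁ w ∨ TermTrace P e₂ w := by
  constructor
  · rintro ⟨w', h, rfl⟩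
    cases h with
    | choice_left h => exact .inl ⟨_, h, rfl⟩
    | choice_right h => exact .inr ⟨_, h, rfl⟩
  · rintro (⟨w, h, rfl⟩ | ⟨w, h, rfl⟩)
    · exact ⟨_, .choice_left h, rfl⟩
    · exact ⟨_, .choice_right h, rfl⟩

variable (P) in
/-- `Calls P e w f`: some execution of `e` issues the events `w` and then calls `f`. -/
inductive Calls : Expr Ev Proc → List Ev → Proc → Prop
  | call (f : Proc) : Calls (.call f) [] f
  | seq_left {e₁ e₂ w f} : Calls e₁ w f → Calls (.seq e₁ e₂) w f
  | seq_right {e₁ e₂ w u f} : TermTrace P e₁ w → Calls e₂ u f → Calls (.seq e₁ e₂) (w ++ u) f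
  | choice_left {e₁ e₂ w f} : Calls e₁ w f → Calls (.choice e₁ e₂) w f
  | choice_right {e₁ e₂ w f} : Calls e₂ w f → Calls (.choice e₁ e₂) w f

theorem not_calls_out {a : Ev} {w : List Ev} {f : Proc} : ¬ Calls P (.out a) w f := nofun

theorem calls_call {g : Proc} {w : List Ev} {f : Proc} :
    Calls P (.call g) w f ↔ w = [] ∧ f = g := by
  constructor
  · rintro ⟨⟩
    exact ⟨rfl, rfl⟩
  · rintro ⟨rfl, rfl⟩
    exact .call _

theorem calls_seq {e₁ e₂ : Expr Ev Proc} {w : List Ev} {f : Proc} :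
    Calls P (.seq e₁ e₂) w f ↔
      Calls P e₁ w f ∨ ∃ a, TermTrace P e₁ a ∧ ∃ b, Calls P e₂ b f ∧ a ++ b = w := by
  constructor
  · intro h
    cases h with
    | seq_left h => exact .inl h
    | seq_right h h' => exact .inr ⟨_, h, _, h', rfl⟩
  · rintro (h | ⟨a, ha, b, hb, rfl⟩)
    · exact .seq_left h
    · exact .seq_right ha hb

theorem calls_choice {e₁ e₂ : Expr Ev Proc} {w : List Ev} {f : Proc} :
    Calls P (.choice e₁ e₂) w f ↔ Calls P e₁ w f ∨ Calls P e₂ w f := by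
  constructor
  · intro h
    cases h with
    | choice_left h => exact .inl h
    | choice_right h => exact .inr h
  · rintro (h | h)
    · exact .choice_left h
    · exact .choice_right h

/-! Observations are closed under prefixes. -/

theorem prefix_append_cases {α : Type*} {u a b : List α} (h : u <+: a ++ b) :
    u <+: a ∨ ∃ c, u = a ++ c ∧ c <+: b := by
  rcases le_total u.length a.length with hl | hl
  · exact .inl (List.prefix_of_prefix_length_le h (List.prefix_append a b) hl)
  · obtain ⟨c, rfl⟩ := List.prefix_of_prefix_length_le (List.prefix_append a b) h hl
    exact .inr ⟨c, rfl, (List.prefix_append_right_inj a).1 h⟩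

theorem Terminates.observes {e : Expr Ev Proc} {w : List (Option Ev)} (h : Terminates P e w) :
    ∀ {u}, u <+: w → Observes P e u := by
  induction h with
  | out a =>
    intro u hu
    rcases List.prefix_cons_iff.1 hu with rfl | ⟨t, rfl, ht⟩
    · exact .nil _
    · rw [List.prefix_nil.1 ht]
      exact .out a
  | call h ih =>
    intro u hu
    rcases List.prefix_cons_iff.1 hu with rfl | ⟨t, rfl, ht⟩
    · exact .nil _
    · exact .call (ih ht)
  | seq h₁ h₂ ih₁ ih₂ =>
    intro u hu
    rcases prefix_append_cases hu with hu | ⟨c, rfl, hc⟩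
    · exact .seq_left (ih₁ hu)
    · exact .seq_right h₁ (ih₂ hc)
  | choice_left _ ih => exact fun hu => .choice_left (ih hu)
  | choice_right _ ih => exact fun hu => .choice_right (ih hu)

theorem Observes.mono {e : Expr Ev Proc} {w : List (Option Ev)} (h : Observes P e w) :
    ∀ {u}, u <+: w → Observes P e u := by
  induction h with
  | out a => exact fun hu => (Terminates.out a).observes hu
  | nil e => exact fun hu => List.prefix_nil.1 hu ▸ .nil e
  | call h ih =>
    intro u hu
    rcases List.prefix_cons_iff.1 hu with rfl | ⟨t, rfl, ht⟩
    · exact .nil _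
    · exact .call (ih ht)
  | seq_right h₁ h₂ ih₂ =>
    intro u hu
    rcases prefix_append_cases hu with hu | ⟨c, rfl, hc⟩
    · exact .seq_left (h₁.observes hu)
    · exact .seq_right h₁ (ih₂ hc)
  | seq_left _ ih => exact fun hu => .seq_left (ih hu)
  | choice_left _ ih => exact fun hu => .choice_left (ih hu)
  | choice_right _ ih => exact fun hu => .choice_right (ih hu)

variable (P) in
/-- All finite prefixes of the infinite extended word `s` are observed. -/
def ObservesInf (e : Expr Ev Proc) (s : ℕ → Option Ev) : Prop :=
  ∀ n, Observes P e (initial s n)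

theorem observesInf_iff {e : Expr Ev Proc} {s : ℕ → Option Ev} :
    ObservesInf P e s ↔ ∀ u, HasPrefix u (.inf s) → Observes P e u := by
  constructor
  · intro h u hu
    rw [hasPrefix_inf_iff.1 hu]
    exact h _
  · intro h n
    apply h
    rw [hasPrefix_inf_iff]
    simp [initial]

/-- A König argument by structural induction. Observations are closed under prefixes, so one branch
of a choice must account for all prefixes. In a sequence, either `e₁` accounts for all of them, or
it terminates at one of finitely many positions, and one of these serves arbitrarily long prefixes.
-/
theorem ObservesInf.exists_calls {e : Expr Ev Proc} {s : ℕ → Option Ev} (h : ObservesInf P e s) :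
    ∃ k f, Calls P e (partialCat (fun i => (s i).toList) k) f ∧
      ObservesInf P (.call f) fun i => s (k + i) := by
  induction e generalizing s with
  | out a =>
    -- An output is observed only up to length one.
    have h₂ := h 2
    generalize hu : initial s 2 = u at h₂
    have hl := congrArg List.length hu
    rw [length_initial] at hl
    cases h₂ <;> simp at hl
  | call f => exact ⟨0, f, .call f, by simpa using h⟩
  | choice e₁ e₂ ih₁ ih₂ =>
    by_cases h₁ : ObservesInf P e₁ s
    · obtain ⟨k, f, hf, hk⟩ := ih₁ h₁
      exact ⟨k, f, .choice_left hf, hk⟩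
    · have h₂ : ObservesInf P e₂ s := by
        by_contra h₂
        simp only [ObservesInf, not_forall] at h₁ h₂
        obtain ⟨m, hm⟩ := h₁
        obtain ⟨n, hn⟩ := h₂
        have hmn := h (m + n)
        generalize hu : initial s (m + n) = u at hmn
        cases hmn with
        | nil => exact hm (.mono (.nil _) (hu ▸ initial_isPrefix s (by omega)))
        | choice_left h' => exact hm (h'.mono (hu ▸ initial_isPrefix s (by omega)))
        | choice_right h' => exact hn (h'.mono (hu ▸ initial_isPrefix s (by omega)))
      obtain ⟨k, f, hf, hk⟩ := ih₂ h₂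
      exact ⟨k, f, .choice_right hf, hk⟩
  | seq e₁ e₂ ih₁ ih₂ =>
    by_cases h₁ : ObservesInf P e₁ s
    · obtain ⟨k, f, hf, hk⟩ := ih₁ h₁
      exact ⟨k, f, .seq_left hf, hk⟩
    · simp only [ObservesInf, not_forall] at h₁
      obtain ⟨N, hN⟩ := h₁
      -- beyond `N` the execution has left `e₁`, at one of finitely many positions
      have split : ∀ n, N ≤ n → ∃ k < N, Terminates P e₁ (initial s k) ∧
          Observes P e₂ (initial (fun i => s (k + i)) (n - k)) := by
        intro n hn
        have hh := h n
        generalize hu : initial s n = u at hh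
        cases hh with
        | nil => exact absurd (Observes.mono (.nil _) (hu ▸ initial_isPrefix s hn)) hN
        | seq_left h' => exact absurd (h'.mono (hu ▸ initial_isPrefix s hn)) hN
        | @seq_right _ _ w v hw hv =>
          have hlen := congrArg List.length hu
          rw [length_initial, List.length_append] at hlen
          obtain ⟨e₁, e₂⟩ := eq_initial_of_append_eq hu.symm
          refine ⟨w.length, ?_, e₁ ▸ hw, ?_⟩
          · by_contra hc
            exact hN (hw.observes (by rw [e₁]; exact initial_isPrefix s (by omega)))
          · rw [show n - w.length = v.length by omega, ← e₂]
            exact hv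
      obtain ⟨k, hk₁, hk₂⟩ : ∃ k, Terminates P e₁ (initial s k) ∧
          ObservesInf P e₂ fun i => s (k + i) := by
        by_contra hc
        have hm : ∀ k, ∃ m, Terminates P e₁ (initial s k) →
            ¬ Observes P e₂ (initial (fun i => s (k + i)) m) := by
          intro k
          by_cases hk : Terminates P e₁ (initial s k)
          · by_contra hm
            push Not at hm
            exact hc ⟨k, hk, fun m => (hm m).2⟩
          · exact ⟨0, fun h => absurd h hk⟩
        choose m hm using hm
        -- This prefix is so long that, wherever `e₁` terminates at `k < N`, the rest has length at
        -- least `m k`, the length at which `e₂` fails.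
        obtain ⟨k, hkN, hk₁, hk₂⟩ := split (N + ∑ k ∈ Finset.range N, m k) (by omega)
        have := Finset.single_le_sum (f := m) (fun _ _ => Nat.zero_le _) (Finset.mem_range.2 hkN)
        exact hm k hk₁ (hk₂.mono (initial_isPrefix _ (by omega)))
      obtain ⟨j, f, hf, hj⟩ := ih₂ hk₂
      refine ⟨k + j, f, ?_, by simpa only [add_assoc] using hj⟩
      rw [partialCat_add]
      exact .seq_right ⟨_, hk₁, (reduceOption_initial s k).symm⟩ hf

theorem observesInf_call {f : Proc} {s : ℕ → Option Ev} (h : ObservesInf P (.call f) s) :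
    s 0 = none ∧ ObservesInf P (P f) fun i => s (1 + i) := by
  have key : ∀ n, s 0 = none ∧ Observes P (P f) (initial (fun i => s (1 + i)) n) := by
    intro n
    have hn := h (1 + n)
    rw [initial_add] at hn
    generalize hu : initial s 1 ++ initial (fun i => s (1 + i)) n = u at hn
    have e : initial s 1 = [s 0] := rfl
    rw [e, List.singleton_append] at hu
    cases hn with
    | nil => cases hu
    | call hw =>
      obtain ⟨h₁, rfl⟩ := List.cons.inj hu
      exact ⟨h₁, hw⟩
  exact ⟨(key 0).1, fun n => (key n).2⟩

/-- A nonterminating execution reaches a call after finitely many steps and continues in the body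
of the called procedure. -/
theorem ObservesInf.exists_step {e : Expr Ev Proc} {s : ℕ → Option Ev} (h : ObservesInf P e s) :
    ∃ k f, 0 < k ∧ Calls P e (partialCat (fun i => (s i).toList) k) f ∧
      ObservesInf P (P f) fun i => s (k + i) := by
  obtain ⟨k, f, hf, hk⟩ := h.exists_calls
  obtain ⟨h0, hk⟩ := observesInf_call hk
  -- The extra position is the tick of the call: it is erased from the trace but guarantees
  -- progress.
  refine ⟨k + 1, f, k.succ_pos, ?_, by simpa only [add_assoc] using hk⟩
  rw [partialCat_succ]
  simp only [add_zero] at h0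
  simpa [h0] using hf

/-- The erased ticks are restored once and for all: a single extended word `w'` serves every
continuation `v`, as is needed to observe all prefixes of one infinite word. -/
theorem Calls.exists_observes {e : Expr Ev Proc} {w : List Ev} {f : Proc} (h : Calls P e w f) :
    ∃ w', w = w'.reduceOption ∧ ∀ v, Observes P (.call f) v → Observes P e (w' ++ v) := by
  induction h with
  | call f => exact ⟨[], rfl, fun v hv => hv⟩
  | seq_left _ ih =>
    obtain ⟨w', rfl, h⟩ := ih
    exact ⟨w', rfl, fun v hv => .seq_left (h v hv)⟩
  | seq_right ha _ ih =>
    obtain ⟨a, ha, rfl⟩ := ha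
    obtain ⟨w', rfl, h⟩ := ih
    refine ⟨a ++ w', (List.reduceOption_append _ _).symm, fun v hv => ?_⟩
    rw [List.append_assoc]
    exact .seq_right ha (h v hv)
  | choice_left _ ih =>
    obtain ⟨w', rfl, h⟩ := ih
    exact ⟨w', rfl, fun v hv => .choice_left (h v hv)⟩
  | choice_right _ ih =>
    obtain ⟨w', rfl, h⟩ := ih
    exact ⟨w', rfl, fun v hv => .choice_right (h v hv)⟩

/-! ### Call chains relative to a set of excluded procedures. -/

variable (P) in
/-- An infinite chain of nested calls from `e`, with the procedures `g n` outside `S` and the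
events `u n` issued before the `n`-th call. -/
structure CallChain (S : Set Proc) (e : Expr Ev Proc) (u : ℕ → List Ev) (g : ℕ → Proc) : Prop where
  zero : Calls P e (u 0) (g 0)
  succ : ∀ n, Calls P (P (g n)) (u (n + 1)) (g (n + 1))
  notMem : ∀ n, g n ∉ S

variable (P) in
/-- The traces of the nonterminating executions of `e` whose pending calls are outside `S`. -/
def Diverges (S : Set Proc) (e : Expr Ev Proc) : Set (Trace Ev) :=
  {w | ∃ u g, CallChain P S e u g ∧ IsInfCat u w}

theorem CallChain.drop {S : Set Proc} {e : Expr Ev Proc} {u : ℕ → List Ev} {g : ℕ → Proc}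
    (h : CallChain P S e u g) (m : ℕ) :
    CallChain P S (P (g m)) (fun i => u (m + 1 + i)) (fun i => g (m + 1 + i)) where
  zero := h.succ m
  succ n := h.succ (m + 1 + n)
  notMem _ := h.notMem _

theorem NontermTrace.mem_diverges {e : Expr Ev Proc} {w : Trace Ev} (h : NontermTrace P e w) :
    w ∈ Diverges P ∅ e := by
  obtain ⟨s, hs, hw⟩ := h
  rw [← observesInf_iff] at hs
  -- A state is an expression together with the position from which it accounts for the rest of `s`;
  -- iterating `next` follows the pending calls.
  let St := {x : Expr Ev Proc × ℕ // ObservesInf P x.1 fun i => s (x.2 + i)}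
  choose k f hk hf hkf using fun x : St => x.2.exists_step
  let next : St → St := fun x =>
    ⟨(P (f x), x.1.2 + k x), by simpa only [add_assoc] using hkf x⟩
  let x : ℕ → St := fun n => next^[n] ⟨(e, 0), by simpa using hs⟩
  have hx : ∀ n, x (n + 1) = next (x n) := fun n => Function.iterate_succ_apply' _ _ _
  have hm : StrictMono fun n => (x n).1.2 := strictMono_nat_of_lt_succ fun n => by
    simp only [hx, next]
    have := hk (x n)
    omega
  have hcalls : ∀ n, Calls P (x n).1.1
      (Trace.segment (fun i => (s i).toList) (x n).1.2 (x (n + 1)).1.2) (f (x n)) := by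
    intro n
    have := hf (x n)
    simpa [Trace.segment, hx, next] using this
  refine ⟨fun n => Trace.segment (fun i => (s i).toList) (x n).1.2 (x (n + 1)).1.2,
    fun n => f (x n), ⟨hcalls 0, fun n => ?_, fun _ => Set.notMem_empty _⟩,
    (isInfCat_segment hm rfl).2 hw⟩
  have := hcalls (n + 1)
  rw [show (x (n + 1)).1.1 = P (f (x n)) by rw [hx]] at this
  exact this

theorem nontermTrace_of_mem_diverges {e : Expr Ev Proc} {w : Trace Ev}
    (h : w ∈ Diverges P ∅ e) : NontermTrace P e w := by
  obtain ⟨u, g, hc, hw⟩ := h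
  obtain ⟨t, ht, htobs⟩ : ∃ t : ℕ → List (Option Ev), (∀ n, u n = (t n).reduceOption) ∧
      (∀ v, Observes P (.call (g 0)) v → Observes P e (t 0 ++ v)) ∧
      ∀ n v, Observes P (.call (g (n + 1))) v → Observes P (P (g n)) (t (n + 1) ++ v) := by
    obtain ⟨t₀, h₀, h₀'⟩ := hc.zero.exists_observes
    choose t h h' using fun n => (hc.succ n).exists_observes
    exact ⟨fun n => n.casesOn t₀ t, fun n => by cases n <;> simp [*], h₀', h'⟩
  -- Each factor ends with the tick of its call. Hence all factors are nonempty and the extended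
  -- word is infinite, even where the trace `w` is finite.
  have hobs : ∀ n, Observes P e (partialCat (fun i => t i ++ [none]) n) := by
    clear hw hc ht
    intro n
    induction n generalizing e t g with
    | zero => exact .nil _
    | succ n ih =>
      rw [partialCat_succ', List.append_assoc]
      exact htobs.1 _ (.call (ih (g := fun i => g (i + 1)) (t := fun i => t (i + 1))
        ⟨htobs.2 0, fun n => htobs.2 (n + 1)⟩))
  obtain ⟨z, hz, -⟩ := existsUnique_isInfCat fun i => t i ++ [none]
  have hne : ∀ i, t i ++ [(none : Option Ev)] ≠ [] := by simp
  obtain ⟨s, rfl⟩ := hz.eq_inf hne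
  refine ⟨s, fun l hl => ?_, ?_⟩
  · obtain ⟨n, hn⟩ := (hz l).1 hl
    exact (hobs n).mono hn
  · have hk := length_partialCat_strictMono hne
    rw [IsErasure, ← isInfCat_segment hk rfl]
    convert hw using 2 with i
    -- Erased blocks are compared through the erased prefixes up to their two ends, which are
    -- partial concatenations of `u`.
    apply List.append_cancel_left (as := partialCat (fun i => (s i).toList)
      (partialCat (fun i => t i ++ [none]) i).length)
    have hred : ∀ n, partialCat (fun i => (s i).toList)
        (partialCat (fun i => t i ++ [none]) n).length = partialCat u n := by
      intro n
      rw [← reduceOption_initial, initial, ← hasPrefix_inf_iff.1 (hz.hasPrefix n)]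
      induction n with
      | zero => rfl
      | succ n ih =>
        rw [partialCat_succ, partialCat_succ, List.reduceOption_append, ih,
          List.reduceOption_append, ← ht]
        simp [List.reduceOption]
    rw [partialCat_append_segment _ (hk i.lt_succ_self).le, hred, hred, partialCat_succ]

theorem nontermTrace_iff {e : Expr Ev Proc} {w : Trace Ev} :
    NontermTrace P e w ↔ w ∈ Diverges P ∅ e :=
  ⟨NontermTrace.mem_diverges, nontermTrace_of_mem_diverges⟩

/-- Peeling off the first call of a chain: this carries equations for `Calls` over to `Diverges`
without coinduction. -/
theorem mem_diverges_iff {S : Set Proc} {e : Expr Ev Proc} {w : Trace Ev} :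
    w ∈ Diverges P S e ↔
      ∃ a f, Calls P e a f ∧ f ∉ S ∧ ∃ v ∈ Diverges P S (P f), w = append a v := by
  constructor
  · rintro ⟨u, g, hc, hw⟩
    obtain ⟨r, rfl, hr⟩ := hw.tail
    exact ⟨_, _, hc.zero, hc.notMem 0, r, ⟨fun i => u (i + 1), fun i => g (i + 1),
      ⟨hc.succ 0, fun n => hc.succ (n + 1), fun n => hc.notMem _⟩, hr⟩, rfl⟩
  · rintro ⟨a, f, ha, hf, v, ⟨u, g, hc, hv⟩, rfl⟩
    refine ⟨fun n => n.casesOn a u, fun n => n.casesOn f g, ⟨ha, fun n => ?_, fun n => ?_⟩,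
      IsInfCat.cons (u := fun n => n.casesOn a u) hv⟩
    · cases n with
      | zero => exact hc.zero
      | succ n => exact hc.succ n
    · cases n with
      | zero => exact hf
      | succ n => exact hc.notMem n

/-! ### Finite runs and the unfolding of recursion. -/

variable (P) in
/-- `Run P S e w g`: some execution of `e` issues the events `w` and then calls `g`, where the
calls that are pending at that time are outside `S`. -/
inductive Run (S : Set Proc) : Expr Ev Proc → List Ev → Proc → Prop
  | calls {e w g} : Calls P e w g → Run S e w g
  | step {e w f v g} : Calls P e w f → f ∉ S → Run S (P f) v g → Run S e (w ++ v) g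

theorem run_iff {S : Set Proc} {e : Expr Ev Proc} {w : List Ev} {g : Proc} :
    Run P S e w g ↔ Calls P e w g ∨
      ∃ a f, Calls P e a f ∧ f ∉ S ∧ ∃ v, Run P S (P f) v g ∧ w = a ++ v := by
  constructor
  · intro h
    cases h with
    | calls h => exact .inl h
    | step h₁ h₂ h₃ => exact .inr ⟨_, _, h₁, h₂, _, h₃, rfl⟩
  · rintro (h | ⟨a, f, h₁, h₂, v, h₃, rfl⟩)
    · exact .calls h
    · exact .step h₁ h₂ h₃

theorem Run.mono {S S' : Set Proc} (hS : S ⊆ S') {e : Expr Ev Proc} {w : List Ev} {g : Proc}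
    (h : Run P S' e w g) : Run P S e w g := by
  induction h with
  | calls h => exact .calls h
  | step h hf _ ih => exact .step h (fun h => hf (hS h)) ih

theorem Run.append {S S' : Set Proc} (hS : S ⊆ S') {e : Expr Ev Proc} {w v : List Ev} {f g : Proc}
    (h : Run P S' e w f) (hf : f ∉ S) (hv : Run P S (P f) v g) : Run P S e (w ++ v) g := by
  induction h with
  | calls h => exact .step h hf hv
  | step h hf' _ ih =>
    rw [List.append_assoc]
    exact .step h (fun h => hf' (hS h)) (ih hf hv)

theorem Run.append_mem_diverges {S S' : Set Proc} (hS : S ⊆ S') {e : Expr Ev Proc} {w : List Ev}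
    {v : Trace Ev} {f : Proc} (h : Run P S' e w f) (hf : f ∉ S) (hv : v ∈ Diverges P S (P f)) :
    Trace.append w v ∈ Diverges P S e := by
  induction h with
  | calls h => exact mem_diverges_iff.2 ⟨_, _, h, hf, v, hv, rfl⟩
  | step h hf' _ ih =>
    rw [append_append]
    exact mem_diverges_iff.2 ⟨_, _, h, fun h => hf' (hS h), _, ih hf hv, rfl⟩

theorem diverges_anti {S S' : Set Proc} (hS : S ⊆ S') (e : Expr Ev Proc) :
    Diverges P S' e ⊆ Diverges P S e := fun _ ⟨u, g, hc, hw⟩ =>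
  ⟨u, g, ⟨hc.zero, hc.succ, fun n h => hc.notMem n (hS h)⟩, hw⟩

theorem Run.exists_chain {S : Set Proc} {e : Expr Ev Proc} {w : List Ev} {f : Proc}
    (h : Run P S e w f) : ∃ (n : ℕ) (u : ℕ → List Ev) (g : ℕ → Proc), Calls P e (u 0) (g 0) ∧
      (∀ j < n, Calls P (P (g j)) (u (j + 1)) (g (j + 1)) ∧ g j ∉ S) ∧ g n = f ∧
      partialCat u (n + 1) = w := by
  induction h with
  | @calls e w g h => exact ⟨0, fun _ => w, fun _ => g, h, by simp, rfl, by simp [partialCat]⟩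
  | @step e w f v g h hf _ ih =>
    obtain ⟨n, u, g', h₀, h₁, rfl, rfl⟩ := ih
    refine ⟨n + 1, fun n => n.casesOn w u, fun n => n.casesOn f g', h, ?_, rfl, ?_⟩
    · intro j hj
      cases j with
      | zero => exact ⟨h₀, hf⟩
      | succ j => exact h₁ j (by omega)
    · exact partialCat_succ' _ (n + 1)

theorem CallChain.run {S : Set Proc} {e : Expr Ev Proc} {u : ℕ → List Ev} {g : ℕ → Proc}
    (h : CallChain P S e u g) {f : Proc} {m : ℕ} (hm : g m = f) (hlt : ∀ j < m, g j ≠ f) :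
    Run P (insert f S) e (partialCat u (m + 1)) f := by
  induction m generalizing e u g with
  | zero =>
    rw [← hm]
    simpa [partialCat] using Run.calls h.zero
  | succ m ih =>
    rw [partialCat_succ']
    refine .step h.zero ?_ (ih (u := fun i => u (i + 1)) (g := fun i => g (i + 1)) ⟨h.succ 0,
      fun n => h.succ (n + 1), fun n => h.notMem _⟩ hm fun j hj => hlt (j + 1) (by omega))
    rintro (h' | h')
    · exact hlt 0 (by omega) h'
    · exact h.notMem 0 h'

open ExtBuchi in
/-- Unfolding the recursion of `f` in terms of the cycles through `f`: finite runs. -/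
theorem run_eq_starLang_append {S : Set Proc} {f : Proc} (hf : f ∉ S) (g : Proc) :
    {w | Run P S (P f) w g} = Set.image2 (· ++ ·) (starLang {w | Run P (insert f S) (P f) w f})
      {w | Run P (insert f S) (P f) w g} := by
  have hS : S ⊆ insert f S := Set.subset_insert f S
  ext w
  constructor
  -- The run is cut at its first pending call of `f`. The start `e` must be arbitrary, since the
  -- part before that cut may start in any expression.
  · have key : ∀ {e w}, Run P S e w g → Run P (insert f S) e w g ∨ ∃ a b, w = a ++ b ∧
        Run P (insert f S) e a f ∧ b ∈ Set.image2 (· ++ ·)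
          (starLang {w | Run P (insert f S) (P f) w f}) {w | Run P (insert f S) (P f) w g} := by
      intro e w h
      induction h with
      | calls h => exact .inl (.calls h)
      | @step e w h v g hc hh _ ih =>
        by_cases hhf : h = f
        · subst hhf
          refine .inr ⟨w, v, rfl, .calls hc, ?_⟩
          rcases ih with ih | ⟨a, b, rfl, ha, x, hx, y, hy, rfl⟩
          · exact ⟨[], nil_mem_starLang _, v, ih, rfl⟩
          · exact ⟨a ++ x, append_mem_starLang ha hx, y, hy, List.append_assoc _ _ _⟩
        · have hh' : h ∉ insert f S := by simp [hhf, hh]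
          rcases ih with ih | ⟨a, b, rfl, ha, hb⟩
          · exact .inl (.step hc hh' ih)
          · exact .inr ⟨w ++ a, b, (List.append_assoc _ _ _).symm, .step hc hh' ha, hb⟩
    intro h
    rcases key h with h | ⟨a, b, rfl, ha, x, hx, y, hy, rfl⟩
    · exact ⟨[], nil_mem_starLang _, w, h, rfl⟩
    · exact ⟨a ++ x, append_mem_starLang ha hx, y, hy, List.append_assoc _ _ _⟩
  · rintro ⟨x, hx, y, hy, rfl⟩
    refine starLang_induction (p := fun x => Run P S (P f) (x ++ y) g) (hy.mono hS) ?_ hx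
    intro a ha w hw
    rw [List.append_assoc]
    exact Run.append hS ha hf hw

/-- Each factor is a finite chain from the body of `f` back to a call of `f`, so the last call of
one chain is followed by the first call of the next. -/
theorem omegaPow_subset_diverges {S : Set Proc} {f : Proc} (hf : f ∉ S) :
    omegaPow {w | Run P (insert f S) (P f) w f} ⊆ Diverges P S (P f) := by
  rintro w ⟨r, hr, hw⟩
  choose n u g h₀ h₁ h₂ h₃ using fun i => (hr i).exists_chain
  -- The `j`-th chain contributes `n j + 1` calls, numbered from `0` to `n j`.
  let k : ℕ → ℕ := fun i => ∑ j ∈ Finset.range i, (n j + 1)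
  have hks : ∀ i, k (i + 1) = k i + (n i + 1) := fun i => Finset.sum_range_succ _ _
  have hk : StrictMono k := strictMono_nat_of_lt_succ fun i => by rw [hks]; omega
  obtain ⟨ρ, hρ⟩ := exists_glue hk rfl fun i j => (u i j, g i j)
  have hρ' : ∀ i j, j ≤ n i → ρ (k i + j) = (u i j, g i j) := fun i j hj =>
    hρ i j (by rw [hks]; omega)
  refine ⟨fun m => (ρ m).1, fun m => (ρ m).2, ⟨?_, fun m => ?_, fun m => ?_⟩, ?_⟩
  · rw [show ρ 0 = _ from hρ' 0 0 (Nat.zero_le _)]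
    exact h₀ 0
  · obtain ⟨i, j, rfl, hlt⟩ := exists_block hk rfl m
    rw [hks] at hlt
    rcases Nat.lt_or_ge j (n i) with hj | hj
    · rw [add_assoc, hρ' i j hj.le, hρ' i (j + 1) hj]
      exact (h₁ i j hj).1
    · obtain rfl : j = n i := by omega
      rw [add_assoc, ← hks, show ρ (k (i + 1)) = _ from hρ' (i + 1) 0 (Nat.zero_le _),
        hρ' i _ le_rfl, h₂]
      exact h₀ (i + 1)
  · obtain ⟨i, j, rfl, hlt⟩ := exists_block hk rfl m
    rw [hks] at hlt
    rw [hρ' i j (by omega)]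
    rcases Nat.lt_or_ge j (n i) with hj | hj
    · exact fun h => (h₁ i j hj).2 (Set.mem_insert_of_mem _ h)
    · obtain rfl : j = n i := by omega
      rwa [h₂]
  · rw [← isInfCat_segment hk rfl]
    convert hw using 2 with i
    rw [← h₃ i, Trace.segment, hks, Nat.add_sub_cancel_left]
    exact partialCat_congr fun j hj => by rw [hρ' i j (by omega)]

open ExtBuchi in
/-- Unfolding the recursion of `f` in terms of the cycles through `f`: infinite runs. -/
theorem diverges_eq_starLang_cat {S : Set Proc} {f : Proc} (hf : f ∉ S) :
    Diverges P S (P f) = catSet (starLang {w | Run P (insert f S) (P f) w f})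
      (Diverges P (insert f S) (P f)) ∪ omegaPow {w | Run P (insert f S) (P f) w f} := by
  have hS : S ⊆ insert f S := Set.subset_insert f S
  apply Set.Subset.antisymm
  · rintro w ⟨u, g, hc, hw⟩
    -- If `f` is called infinitely often, the chain splits into cycles through `f`; otherwise
    -- finitely many cycles precede a tail avoiding `f`.
    by_cases hinf : ∀ a, ∃ m, a ≤ m ∧ g m = f
    · right
      classical
      have hnext : ∀ a, ∃ m, a ≤ m ∧ g m = f ∧ ∀ j, a ≤ j → j < m → g j ≠ f := fun a =>
        ⟨Nat.find (hinf a), (Nat.find_spec (hinf a)).1, (Nat.find_spec (hinf a)).2,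
          fun j h₁ h₂ h₃ => Nat.find_min (hinf a) h₂ ⟨h₁, h₃⟩⟩
      choose next hle hg hlt using hnext
      let k : ℕ → ℕ := fun i => (fun a => next a + 1)^[i] 0
      have hks : ∀ i, k (i + 1) = next (k i) + 1 := fun i => Function.iterate_succ_apply' _ _ _
      have hk : StrictMono k := strictMono_nat_of_lt_succ fun i => by
        rw [hks]
        have := hle (k i)
        omega
      refine ⟨_, fun i => ?_, (isInfCat_segment hk rfl).2 hw⟩
      -- Each block begins just after a call of `f`, hence again in its body.
      have hci : CallChain P S (P f) (fun j => u (k i + j)) (fun j => g (k i + j)) := by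
        cases i with
        | zero => simpa [k] using hc
        | succ i =>
          have := hc.drop (next (k i))
          rwa [hg, ← hks] at this
      have hle' := hle (k i)
      have := hci.run (f := f) (m := next (k i) - k i)
        (by rw [Nat.add_sub_cancel' hle', hg])
        (fun j hj => hlt (k i) (k i + j) (by omega) (by omega))
      rw [Trace.segment, hks, show next (k i) + 1 - k i = next (k i) - k i + 1 by omega]
      exact this
    · left
      push Not at hinf
      obtain ⟨N, hN⟩ := hinf
      -- `N` bounds the positions of the calls of `f`; removing the part up to the first such call
      -- lowers the bound.
      induction N using Nat.strong_induction_on generalizing u g w with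
      | _ N ih =>
        by_cases h : ∃ m, g m = f
        · classical
          have hm := Nat.find_spec h
          have hlt : ∀ j < Nat.find h, g j ≠ f := fun j hj => Nat.find_min h hj
          generalize Nat.find h = m at hm hlt
          have hrun := hc.run hm hlt
          obtain ⟨r, rfl, hr⟩ := hw.drop (m + 1)
          have hmN : m < N := by
            by_contra hcon
            exact hN m (by omega) hm
          have hd := hc.drop m
          rw [hm] at hd
          obtain ⟨a, ha, v, hv, rfl⟩ := ih (N - (m + 1)) (by omega) _ _ hd hr
            fun j hj => hN _ (by omega)
          exact ⟨_, append_mem_starLang hrun ha, v, hv, (append_append _ _ _).symm⟩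
        · push Not at h
          refine ⟨[], nil_mem_starLang _, w, ⟨u, g, ⟨hc.zero, hc.succ, fun n => ?_⟩, hw⟩,
            (append_nil w).symm⟩
          rintro (h' | h')
          · exact h n h'
          · exact hc.notMem n h'
  · apply Set.union_subset _ (omegaPow_subset_diverges hf)
    rintro _ ⟨x, hx, v, hv, rfl⟩
    refine starLang_induction (p := fun x => append x v ∈ Diverges P S (P f)) ?_ ?_ hx
    · rw [append_nil]
      exact diverges_anti hS _ hv
    · intro a ha w hw
      rw [append_append]
      exact Run.append_mem_diverges hS ha hf hw

end Semantics

end BuchiEffect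

namespace BuchiEffect

/-! ### Derivations of exact effects -/

section Derivation

open Trace ExtBuchi

variable {Q Ev Proc Var : Type*} (𝔄 : ExtBuchi Q Ev) (P : Program Ev Proc)

/-! ### Equations for runs and divergence along the syntax. -/

theorem run_seq {S : Set Proc} {e₁ e₂ : Expr Ev Proc} (g : Proc) :
    {w | Run P S (.seq e₁ e₂) w g} = {w | Run P S e₁ w g} ∪
      Set.image2 (· ++ ·) {w | TermTrace P e₁ w} {w | Run P S e₂ w g} := by
  ext w
  simp only [Set.mem_union, Set.mem_image2, Set.mem_ofPred_eq]
  rw [run_iff, run_iff (e := e₁)]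
  simp only [run_iff (e := e₂), calls_seq]
  constructor
  · rintro ((h | ⟨a, ha, b, hb, rfl⟩) | ⟨a, f, h | ⟨c, hc, b, hb, rfl⟩, hf, v, hv, rfl⟩)
    · exact .inl (.inl h)
    · exact .inr ⟨a, ha, b, .inl hb, rfl⟩
    · exact .inl (.inr ⟨a, f, h, hf, v, hv, rfl⟩)
    · exact .inr ⟨c, hc, b ++ v, .inr ⟨b, f, hb, hf, v, hv, rfl⟩, (List.append_assoc _ _ _).symm⟩
  · rintro ((h | ⟨a, f, h, hf, v, hv, rfl⟩) | ⟨a, ha, b, hb | ⟨c, f, hc, hf, v, hv, rfl⟩, rfl⟩)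
    · exact .inl (.inl h)
    · exact .inr ⟨a, f, .inl h, hf, v, hv, rfl⟩
    · exact .inl (.inr ⟨a, ha, b, hb, rfl⟩)
    · exact .inr ⟨a ++ c, f, .inr ⟨a, ha, c, hc, rfl⟩, hf, v, hv, (List.append_assoc _ _ _).symm⟩

theorem run_choice {S : Set Proc} {e₁ e₂ : Expr Ev Proc} (g : Proc) :
    {w | Run P S (.choice e₁ e₂) w g} = {w | Run P S e₁ w g} ∪ {w | Run P S e₂ w g} := by
  ext w
  simp only [Set.mem_union, Set.mem_ofPred_eq]
  rw [run_iff, run_iff (e := e₁), run_iff (e := e₂)]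
  simp only [calls_choice]
  grind

theorem run_call {S : Set Proc} {f : Proc} (g : Proc) {w : List Ev} :
    Run P S (.call f) w g ↔ (w = [] ∧ g = f) ∨ f ∉ S ∧ Run P S (P f) w g := by
  rw [run_iff]
  simp only [calls_call]
  constructor
  · rintro (h | ⟨a, f, ⟨rfl, rfl⟩, hf, v, hv, rfl⟩)
    · exact .inl h
    · exact .inr ⟨hf, hv⟩
  · rintro (h | ⟨hf, hv⟩)
    · exact .inl h
    · exact .inr ⟨[], f, ⟨rfl, rfl⟩, hf, w, hv, rfl⟩

theorem diverges_seq (S : Set Proc) (e₁ e₂ : Expr Ev Proc) :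
    Diverges P S (.seq e₁ e₂) =
      Diverges P S e₁ ∪ catSet {w | TermTrace P e₁ w} (Diverges P S e₂) := by
  ext w
  rw [Set.mem_union, mem_diverges_iff, mem_diverges_iff (e := e₁)]
  simp only [calls_seq, catSet, Set.mem_ofPred_eq]
  constructor
  · rintro ⟨a, f, h | ⟨c, hc, b, hb, rfl⟩, hf, v, hv, rfl⟩
    · exact .inl ⟨a, f, h, hf, v, hv, rfl⟩
    · exact .inr ⟨c, hc, append b v, mem_diverges_iff.2 ⟨b, f, hb, hf, v, hv, rfl⟩,
        append_append _ _ _⟩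
  · rintro (⟨a, f, h, hf, v, hv, rfl⟩ | ⟨a, ha, b, hb, rfl⟩)
    · exact ⟨a, f, .inl h, hf, v, hv, rfl⟩
    · obtain ⟨c, f, hc, hf, v, hv, rfl⟩ := mem_diverges_iff.1 hb
      exact ⟨a ++ c, f, .inr ⟨a, ha, c, hc, rfl⟩, hf, v, hv, (append_append _ _ _).symm⟩

theorem diverges_choice (S : Set Proc) (e₁ e₂ : Expr Ev Proc) :
    Diverges P S (.choice e₁ e₂) = Diverges P S e₁ ∪ Diverges P S e₂ := by
  ext w
  rw [Set.mem_union, mem_diverges_iff, mem_diverges_iff (e := e₁), mem_diverges_iff (e := e₂)]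
  simp only [calls_choice]
  grind

theorem mem_diverges_call {S : Set Proc} {f : Proc} {w : Trace Ev} :
    w ∈ Diverges P S (.call f) ↔ f ∉ S ∧ w ∈ Diverges P S (P f) := by
  rw [mem_diverges_iff]
  simp only [calls_call]
  constructor
  · rintro ⟨_, _, ⟨rfl, rfl⟩, hf, v, hv, rfl⟩
    exact ⟨hf, by rwa [Trace.append_nil]⟩
  · rintro ⟨hf, hv⟩
    exact ⟨[], f, ⟨rfl, rfl⟩, hf, w, hv, (Trace.append_nil w).symm⟩

theorem EffExpr.ext_coeff {𝔄 : ExtBuchi Q Ev} {𝒱 𝒲 : EffExpr 𝔄 Var}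
    (hc : ∀ X, 𝒱.coeff X = 𝒲.coeff X) (hb : 𝒱.base = 𝒲.base) : 𝒱 = 𝒲 := by
  cases 𝒱
  cases 𝒲
  simp only [EffExpr.mk.injEq]
  exact ⟨funext hc, hb⟩

/-! ### Exact effects and their derivation. -/

/-- The exact effect of the terminating executions of `e`. -/
def termEff (e : Expr Ev Proc) : 𝔄.MStar := 𝔄.alphaStar {w | TermTrace P e w}

variable (procVar : Proc ↪ Var)

/-- The exact effect of the nonterminating executions of `e` relative to the procedures in `S`. -/
def divEff (S : Set Proc) (e : Expr Ev Proc) : EffExpr 𝔄 Var where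
  coeff X := {C | ∃ g ∈ S, X = procVar g ∧ C ∈ 𝔄.alphaStar {w | Run P S e w g}}
  base := 𝔄.alphaOmega (Diverges P S e)

/-- The environment that assigns their exact effects to the procedures in `S`. -/
def exactEnv (S : Set Proc) : Env 𝔄 Proc Var where
  items := {b | ∃ g ∈ S, b = ⟨g, termEff 𝔄 P (.call g), procVar g⟩}
  distinct := by
    rintro _ ⟨g, -, rfl⟩ _ ⟨g', -, rfl⟩ h
    obtain rfl := procVar.injective h
    rfl

theorem exactEnv_fresh {S : Set Proc} {f : Proc} (hf : f ∉ S) :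
    (exactEnv 𝔄 P procVar S).Fresh (procVar f) := by
  rintro _ ⟨g, hg, rfl⟩ h
  exact hf (procVar.injective h ▸ hg)

theorem exactEnv_extend {S : Set Proc} {f : Proc} (hf : f ∉ S) :
    (exactEnv 𝔄 P procVar S).extend f (termEff 𝔄 P (.call f)) (procVar f)
      (exactEnv_fresh 𝔄 P procVar hf) = exactEnv 𝔄 P procVar (insert f S) := by
  simp only [Env.extend, exactEnv, Env.mk.injEq]
  ext b
  simp

theorem divEff_out (S : Set Proc) (a : Ev) :
    divEff 𝔄 P procVar S (.out a) = .const 𝔄.omegaEmpty := by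
  refine EffExpr.ext_coeff (fun X => ?_) ?_
  · refine Set.eq_empty_of_forall_notMem ?_
    rintro C ⟨g, -, -, hC⟩
    obtain ⟨w, hw, -⟩ := 𝔄.mem_alphaStar.1 hC
    rcases run_iff.1 hw with h | ⟨_, _, h, -⟩ <;> exact not_calls_out h
  · refine (congrArg _ (Set.eq_empty_of_forall_notMem fun w hw => ?_)).trans 𝔄.alphaOmega_empty
    obtain ⟨_, _, h, -⟩ := mem_diverges_iff.1 hw
    exact not_calls_out h

theorem divEff_seq [Finite Q] (S : Set Proc) (e₁ e₂ : Expr Ev Proc) :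
    divEff 𝔄 P procVar S (.seq e₁ e₂) =
      (divEff 𝔄 P procVar S e₁).union ((divEff 𝔄 P procVar S e₂).cat (termEff 𝔄 P e₁)) := by
  refine EffExpr.ext_coeff (fun X => ?_) ?_
  · ext C
    simp only [divEff, EffExpr.union, EffExpr.cat, run_seq, 𝔄.alphaStar_union,
      𝔄.alphaStar_image2, Set.mem_union, starCat, Set.mem_ofPred_eq, termEff]
    grind
  · simp only [divEff, EffExpr.union, EffExpr.cat, diverges_seq, 𝔄.alphaOmega_union,
      𝔄.alphaOmega_catSet, termEff]

theorem divEff_choice (S : Set Proc) (e₁ e₂ : Expr Ev Proc) :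
    divEff 𝔄 P procVar S (.choice e₁ e₂) =
      (divEff 𝔄 P procVar S e₁).union (divEff 𝔄 P procVar S e₂) := by
  refine EffExpr.ext_coeff (fun X => ?_) ?_
  · ext C
    simp only [divEff, EffExpr.union, run_choice, 𝔄.alphaStar_union, Set.mem_union,
      Set.mem_ofPred_eq]
    grind
  · simp only [divEff, EffExpr.union, diverges_choice, 𝔄.alphaOmega_union]

/-- A call inside `S` is never unfolded: only the empty run to `f` itself remains, and no
divergence. -/
theorem divEff_call_of_mem {S : Set Proc} {f : Proc} (hf : f ∈ S) :
    divEff 𝔄 P procVar S (.call f) = .var (procVar f) := by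
  refine EffExpr.ext_coeff (fun X => ?_) ?_
  · ext C
    simp only [divEff, EffExpr.var, Set.mem_ofPred_eq, 𝔄.mem_alphaStar, run_call, hf,
      not_true, false_and, or_false]
    constructor
    · rintro ⟨g, -, rfl, _, ⟨rfl, rfl⟩, rfl⟩
      simp [cls_nil]
    · intro h
      split_ifs at h with hX
      · exact ⟨f, hf, hX, [], ⟨rfl, rfl⟩, h.symm⟩
      · exact h.elim
  · refine (congrArg _ (Set.eq_empty_of_forall_notMem fun w hw => ?_)).trans 𝔄.alphaOmega_empty
    exact ((mem_diverges_call P).1 hw).1 hf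

open Classical in
/-- The part of the exact effect of `e` without the variable of `f`. -/
noncomputable def divEffAvoid (S : Set Proc) (f : Proc) (e : Expr Ev Proc) : EffExpr 𝔄 Var where
  coeff X := if X = procVar f then ∅ else (divEff 𝔄 P procVar S e).coeff X
  base := (divEff 𝔄 P procVar S e).base

/-- This is the shape that the premise of the recursion rule demands. As `procVar` is injective, the
coefficient of the variable of `f` collects only runs to `f`. -/
theorem divEff_eq_union_avoid {S : Set Proc} {f : Proc} (hf : f ∈ S) (e : Expr Ev Proc) :
    divEff 𝔄 P procVar S e =
      ((EffExpr.var (procVar f)).cat (𝔄.alphaStar {w | Run P S e w f})).union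
        (divEffAvoid 𝔄 P procVar S f e) := by
  refine EffExpr.ext_coeff (fun X => ?_) (Subtype.ext ?_)
  · ext C
    simp only [EffExpr.union, EffExpr.cat, EffExpr.var, divEffAvoid, Set.mem_union, starCat,
      Set.mem_ofPred_eq]
    by_cases hX : X = procVar f
    · subst hX
      simp only [divEff, Set.mem_ofPred_eq, if_true, Set.mem_singleton_iff,
        exists_eq_left, mul_one, exists_eq_right', Set.mem_empty_iff_false, or_false,
        EmbeddingLike.apply_eq_iff_eq]
      grind
    · simp [hX]
  · ext p
    simp [EffExpr.union, EffExpr.cat, EffExpr.var, divEffAvoid, omegaUnion, omegaCat, catPairs,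
      omegaEmpty]

/-- The semantic content of the recursion rule: `𝒜^* ⬝ 𝒱 ∪ 𝒜^ω` is the exact solution because runs
and divergence unfold along the cycles through `f`. -/
theorem divEff_call_of_notMem [Finite Q] {S : Set Proc} {f : Proc} (hf : f ∉ S) :
    divEff 𝔄 P procVar S (.call f) =
      ((divEffAvoid 𝔄 P procVar (insert f S) f (P f)).cat
        (𝔄.starIter (𝔄.alphaStar {w | Run P (insert f S) (P f) w f}))).union
      (.const (𝔄.omegaIter (𝔄.alphaStar {w | Run P (insert f S) (P f) w f}))) := by
  rw [← 𝔄.alphaStar_starLang, 𝔄.omegaIter_alphaStar]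
  refine EffExpr.ext_coeff (fun X => ?_) ?_
  · have hrun : ∀ g ∈ S, 𝔄.alphaStar {w | Run P S (.call f) w g} =
        𝔄.starCat (𝔄.alphaStar (starLang {w | Run P (insert f S) (P f) w f}))
          (𝔄.alphaStar {w | Run P (insert f S) (P f) w g}) := by
      intro g hg
      have hgf : g ≠ f := fun h => hf (h ▸ hg)
      rw [← 𝔄.alphaStar_image2, ← run_eq_starLang_append hf]
      simp [run_call, hgf, hf]
    ext C
    simp only [EffExpr.union, EffExpr.cat, EffExpr.const, Set.union_empty]
    constructor
    · rintro ⟨g, hg, rfl, hC⟩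
      rw [hrun g hg] at hC
      obtain ⟨A, hA, B, hB, rfl⟩ := hC
      refine ⟨A, hA, B, ?_, rfl⟩
      have hgf : g ≠ f := fun h => hf (h ▸ hg)
      simp only [divEffAvoid, EmbeddingLike.apply_eq_iff_eq, hgf, if_false]
      exact ⟨g, Set.mem_insert_of_mem _ hg, rfl, hB⟩
    · rintro ⟨A, hA, B, hB, rfl⟩
      simp only [divEffAvoid] at hB
      split_ifs at hB with hX
      · exact hB.elim
      · obtain ⟨g, hg, rfl, hB⟩ := hB
        have hg' : g ∈ S := hg.resolve_left fun h => hX (h ▸ rfl)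
        exact ⟨g, hg', rfl, by rw [hrun g hg']; exact ⟨A, hA, B, hB, rfl⟩⟩
  · have hdiv : Diverges P S (.call f) = Diverges P S (P f) := by
      ext w
      rw [mem_diverges_call]
      exact and_iff_right hf
    simp only [divEff, EffExpr.union, EffExpr.cat, EffExpr.const, divEffAvoid, hdiv]
    rw [diverges_eq_starLang_cat hf, 𝔄.alphaOmega_union, 𝔄.alphaOmega_catSet]

/-- The exact effects are derivable. -/
theorem derives_exact [Finite Q] [Finite Proc] (S : Set Proc) (e : Expr Ev Proc) :
    Derives 𝔄 P (exactEnv 𝔄 P procVar S) e (termEff 𝔄 P e) (divEff 𝔄 P procVar S e) := by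
  -- The body of a called procedure is not a subexpression of the call, so it is handled with the
  -- larger set `insert f S`; the inner induction is structural.
  induction S using (wellFounded_gt (α := Set Proc)).induction generalizing e with
  | _ S ihS =>
    induction e with
    | out a =>
      rw [divEff_out]
      have : {w | TermTrace P (.out a) w} = {[a]} := Set.ext fun w => termTrace_out
      rw [termEff, this]
      exact .out _ a
    | seq e₁ e₂ ih₁ ih₂ =>
      have : {w | TermTrace P (.seq e₁ e₂) w} =
          Set.image2 (· ++ ·) {w | TermTrace P e₁ w} {w | TermTrace P e₂ w} :=
        Set.ext fun w => termTrace_seq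
      rw [divEff_seq, termEff, this, 𝔄.alphaStar_image2]
      exact .seq ih₁ ih₂
    | choice e₁ e₂ ih₁ ih₂ =>
      have : {w | TermTrace P (.choice e₁ e₂) w} =
          {w | TermTrace P e₁ w} ∪ {w | TermTrace P e₂ w} := Set.ext fun w => termTrace_choice
      rw [divEff_choice, termEff, this, 𝔄.alphaStar_union]
      exact .choice ih₁ ih₂
    | call f =>
      by_cases hf : f ∈ S
      · rw [divEff_call_of_mem 𝔄 P procVar hf]
        exact .hyp ⟨f, hf, rfl⟩
      · rw [divEff_call_of_notMem 𝔄 P procVar hf]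
        refine .fix (exactEnv_fresh 𝔄 P procVar hf) (by simp [EffExpr.Avoids, divEffAvoid]) ?_
        rw [exactEnv_extend 𝔄 P procVar hf, ← divEff_eq_union_avoid 𝔄 P procVar (Set.mem_insert f S)]
        -- The recursion rule wants the same `𝒰` for call and body; they agree since the tick of the
        -- call is erased.
        have : termEff 𝔄 P (.call f) = termEff 𝔄 P (P f) := by
          simp only [termEff, termTrace_call]
        rw [this]
        exact ihS _ (Set.ssubset_insert hf) (P f)

theorem exactEnv_empty : exactEnv 𝔄 P procVar ∅ = Env.empty := by
  simp [exactEnv, Env.empty]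

theorem divEff_empty (e : Expr Ev Proc) :
    divEff 𝔄 P procVar ∅ e = .const (𝔄.alphaOmega (Diverges P ∅ e)) :=
  EffExpr.ext_coeff (fun X => by simp [divEff, EffExpr.const]) rfl

theorem traces_eq (f : Proc) :
    traces P f = Trace.fin '' {w | TermTrace P (.call f) w} ∪ Diverges P ∅ (.call f) := by
  ext w
  simp only [traces, nontermTrace_iff, Set.mem_union, Set.mem_image, Set.mem_ofPred_eq]
  grind

end Derivation

end BuchiEffect

/-! ### The completeness theorem. -/

theorem mainTheorem1 {Q Ev Proc Var : Type*} [Finite Q] [Finite Proc]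
    (𝔄 : BuchiEffect.ExtBuchi Q Ev) (P : BuchiEffect.Program Ev Proc)
    (procVar : Proc ↪ Var) (f : Proc) :
    ∃ (𝒰 : 𝔄.MStar) (𝒱 : 𝔄.MOmega),
      BuchiEffect.Derives 𝔄 P (BuchiEffect.Env.empty : BuchiEffect.Env 𝔄 Proc Var)
        (.call f) 𝒰 (.const 𝒱) ∧
      (BuchiEffect.traces P f ⊆ 𝔄.lang ↔
        BuchiEffect.Trace.fin '' 𝔄.gammaStar 𝒰 ∪ 𝔄.gammaOmega 𝒱 ⊆ 𝔄.lang) := by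
  refine ⟨BuchiEffect.termEff 𝔄 P (.call f),
    𝔄.alphaOmega (BuchiEffect.Diverges P ∅ (.call f)), ?_, ?_⟩
  · rw [← BuchiEffect.exactEnv_empty 𝔄 P procVar, ← BuchiEffect.divEff_empty 𝔄 P procVar]
    exact BuchiEffect.derives_exact 𝔄 P procVar ∅ (.call f)
  · rw [BuchiEffect.traces_eq, Set.union_subset_iff, Set.union_subset_iff,
      𝔄.gammaOmega_alphaOmega_subset_lang, BuchiEffect.termEff,
      𝔄.gammaStar_alphaStar_subset_lang]
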